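/- Fix $A,B>0$ and $a,b\in\mathbb R$. For a positive integer $L$ and $N\ge 0$ labelled particles, consider the following continuous-time Markov process (the label process) of the positions of the particles in $\Lambda_L=\{-L,\dots,L\}\cup\{\delta(-),\delta(+)\}$. There are independent Poisson clocks: one of rate $1$ for each bond $\{k,k+1\}$, $-L\le k\le L-1$, one of rate $A/L^a$ at the site $-L$ and one of rate $B/L^b$ at the site $L$. When the clock of $\{k,k+1\}$ rings and there are $m$ particles on these two sites in total, an integer $U$ uniform on $\{0,\dots,m\}$ and, independently, a uniformly random ordering of the labels of these $m$ particles are chosen; the first $U$ particles in this ordering are sent to $k$ and the remaining ones to $k+1$. When the clock at $-L$ (respectively $L$) rings, all the particles at that site move to $\delta(-)$ (respectively $\delta(+)$) and stay there forever. For $y_1,\dots,y_N\in\{-L,\dots,L\}$ and $\varepsilon_1,\dots,\varepsilon_N\in\{\delta(+),\delta(-)\}$, let $p_L(y_1,\dots,y_N;\varepsilon_1,\dots,\varepsilon_N)$ be the probability that, for the process with $N$ particles started at $y_1,\dots,y_N$, for every $i$ the particle started at $y_i$ hits $\varepsilon_i$. Then for all integers $x_1,\dots,x_N$ (not necessarily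 distinct), all $\varepsilon_1,\dots,\varepsilon_N\in\{\delta(+),\delta(-)\}$ and all $u\in(-1,1)$, $$\lim_{L\to\infty}\Big\{p_L\big(x_1+\lfloor uL\rfloor,\dots,x_N+\lfloor uL\rfloor;\varepsilon_1,\dots,\varepsilon_N\big)-\prod_{i=1}^N p_L\big(x_i+\lfloor uL\rfloor;\varepsilon_i\big)\Big\}=0,$$ where for all sufficiently large $L$ the points $x_i+\lfloor uL\rfloor$ all lie in $\{-L,\dots,L\}$, so that the expression is defined. -/

import Mathlib

open MeasureTheory ProbabilityTheory Filter
open scoped NNReal ENNReal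

noncomputable section

/-- The two absorbing sites: `minus` is `δ(-)` and `plus` is `δ(+)`. -/
inductive Reservoir
  | minus
  | plus
  deriving DecidableEq

instance : Fintype Reservoir :=
  ⟨{Reservoir.minus, Reservoir.plus}, fun s => by cases s <;> simp⟩

/-- The chain `{-L, …, L}`. -/
abbrev Chain (L : ℕ+) : Type := Set.Icc (-(L : ℤ)) (L : ℤ)

/-- The set of sites `Λ_L = {-L, …, L} ∪ {δ(-), δ(+)}`. -/
abbrev Site (L : ℕ+) : Type := Chain L ⊕ Reservoir

instance (L : ℕ+) : MeasurableSpace (Site L) := ⊤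

/-- Positions of `N` labelled particles. -/
abbrev Config (L : ℕ+) (N : ℕ) : Type := Fin N → Site L

/-- The Poisson clocks: one for each bond `{k, k+1}` with `-L ≤ k ≤ L-1` (`Sum.inl k`), one at the
site `-L` (`Sum.inr minus`) and one at the site `L` (`Sum.inr plus`). -/
abbrev Clock (L : ℕ+) : Type := Set.Ico (-(L : ℤ)) (L : ℤ) ⊕ Reservoir

/-- The rates of the clocks: `1` at each bond, `A / L ^ a` at `-L` and `B / L ^ b` at `L`. -/
def clockRate (A B : ℝ≥0) (a b : ℝ) (L : ℕ+) : Clock L → ℝ≥0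
  | Sum.inl _ => 1
  | Sum.inr Reservoir.minus => A / ((L : ℕ) : ℝ≥0) ^ a
  | Sum.inr Reservoir.plus => B / ((L : ℕ) : ℝ≥0) ^ b

/-- The rate of the superposition of all the clocks. -/
def totalRate (A B : ℝ≥0) (a b : ℝ) (L : ℕ+) : ℝ≥0 := ∑ e, clockRate A B a b L e

/-- The site `k` of the bond `{k, k+1}`. -/
def bondLeft {L : ℕ+} (k : Set.Ico (-(L : ℤ)) (L : ℤ)) : Site L :=
  Sum.inl ⟨k, k.2.1, k.2.2.le⟩

/-- The site `k+1` of the bond `{k, k+1}`. -/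
def bondRight {L : ℕ+} (k : Set.Ico (-(L : ℤ)) (L : ℤ)) : Site L :=
  Sum.inl ⟨k + 1, k.2.1.trans (by simp), k.2.2⟩

/-- The site of the chain in contact with a reservoir: `-L` for `δ(-)`, `L` for `δ(+)`. -/
def boundarySite (L : ℕ+) : Reservoir → Site L
  | Reservoir.minus => Sum.inl ⟨-(L : ℤ), le_rfl, by simp⟩
  | Reservoir.plus => Sum.inl ⟨(L : ℤ), by simp, le_rfl⟩

/-- The labels of the particles located at one of the two sites of the bond `{k, k+1}`. -/
abbrev bondLabels {L : ℕ+} {N : ℕ} (k : Set.Ico (-(L : ℤ)) (L : ℤ)) (η : Config L N) : Type :=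
  {i : Fin N // η i = bondLeft k ∨ η i = bondRight k}

/-- Redistribution at the bond `{k, k+1}`: the labels of the `m` particles of the bond are listed
in the order `ζ`; the first `U` of them are sent to `k` and the remaining ones to `k+1`. All the
other particles stay where they are. -/
def redistribute {L : ℕ+} {N : ℕ} (k : Set.Ico (-(L : ℤ)) (L : ℤ)) (η : Config L N) (U : ℕ)
    (ζ : Fin (Fintype.card (bondLabels k η)) ≃ bondLabels k η) : Config L N := fun i =>
  if h : η i = bondLeft k ∨ η i = bondRight k then
    if (ζ.symm ⟨i, h⟩ : ℕ) < U then bondLeft k else bondRight k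
  else η i

instance {L : ℕ+} {N : ℕ} (k : Set.Ico (-(L : ℤ)) (L : ℤ)) (η : Config L N) :
    Nonempty (Fin (Fintype.card (bondLabels k η)) ≃ bondLabels k η) :=
  ⟨(Fintype.equivFin _).symm⟩

/-- The random configuration right after the ring of a clock, from the configuration `η` right
before it. At a bond carrying `m` particles, `U` is uniform on `{0, …, m}` and, independently, the
ordering `ζ` of the `m` labels is uniform. At a boundary site, all the particles of that site move
to the reservoir. -/
def ringUpdate {L : ℕ+} {N : ℕ} (η : Config L N) : Clock L → PMF (Config L N)
  | Sum.inl k =>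
      (PMF.uniformOfFintype (Fin (Fintype.card (bondLabels k η) + 1) ×
        (Fin (Fintype.card (bondLabels k η)) ≃ bondLabels k η))).map
          fun p => redistribute k η p.1 p.2
  | Sum.inr s => PMF.pure fun i => if η i = boundarySite L s then Sum.inr s else η i

theorem totalRate_pos (A B : ℝ≥0) (a b : ℝ) (L : ℕ+) : 0 < totalRate A B a b L := by
  have hk : (0 : ℤ) ∈ Set.Ico (-(L : ℤ)) (L : ℤ) := ⟨by simp, by simp⟩
  calc (0 : ℝ≥0) < clockRate A B a b L (Sum.inl ⟨0, hk⟩) := one_pos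
    _ ≤ totalRate A B a b L :=
      Finset.single_le_sum (f := clockRate A B a b L) (fun _ _ => zero_le) (Finset.mem_univ _)

theorem tsum_clockRate (A B : ℝ≥0) (a b : ℝ) (L : ℕ+) :
    ∑' e, (clockRate A B a b L e : ℝ≥0∞) = totalRate A B a b L := by
  rw [tsum_fintype, totalRate, ENNReal.ofNNReal_finsetSum]

/-- The clock that rings at a given ring of the superposition of the independent Poisson clocks:
it is the clock `e` with probability `clockRate e / totalRate`. -/
def ringingClock (A B : ℝ≥0) (a b : ℝ) (L : ℕ+) : PMF (Clock L) :=
  PMF.normalize (fun e => (clockRate A B a b L e : ℝ≥0∞))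
    (by rw [tsum_clockRate]; exact_mod_cast (totalRate_pos A B a b L).ne')
    (by rw [tsum_clockRate]; exact ENNReal.coe_ne_top)

/-- The transition kernel of the configuration from one ring of the clocks to the next one. -/
def ringKernel (A B : ℝ≥0) (a b : ℝ) (L : ℕ+) (N : ℕ) : Kernel (Config L N) (Config L N) :=
  Kernel.ofFunOfCountable fun η => ((ringingClock A B a b L).bind (ringUpdate η)).toMeasure

instance (A B : ℝ≥0) (a b : ℝ) (L : ℕ+) (N : ℕ) : IsMarkovKernel (ringKernel A B a b L N) :=
  ⟨fun η => by
    change IsProbabilityMeasure ((ringingClock A B a b L).bind (ringUpdate η)).toMeasure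
    infer_instance⟩

/-- The law of the sequence of configurations seen after `0, 1, 2, …` rings of the clocks, from the
initial configuration `η`: the Markov chain with transition kernel `ringKernel`. -/
def ringChainLaw (A B : ℝ≥0) (a b : ℝ) (L : ℕ+) {N : ℕ} (η : Config L N) :
    Measure (ℕ → Config L N) :=
  Kernel.trajMeasure (X := fun _ => Config L N) (Measure.dirac η) fun n =>
    (ringKernel A B a b L N).comap (fun h => h ⟨n, Finset.mem_Iic.2 le_rfl⟩)
      (measurable_pi_apply _)

/-- The probability of the label process started from `η`, on the space of pairs `(τ, Y)` of the
sequence `τ` of the waiting times between successive rings of the clocks, which are independent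
exponential variables of parameter `totalRate`, and the sequence `Y` of the configurations after
each number of rings, which is independent of `τ`. -/
def labelLaw (A B : ℝ≥0) (a b : ℝ) (L : ℕ+) {N : ℕ} (η : Config L N) :
    Measure ((ℕ → ℝ) × (ℕ → Config L N)) :=
  (Measure.infinitePi fun _ : ℕ => expMeasure (totalRate A B a b L)).prod
    (ringChainLaw A B a b L η)

instance (A B : ℝ≥0) (a b : ℝ) (L : ℕ+) {N : ℕ} (η : Config L N) :
    IsProbabilityMeasure (labelLaw A B a b L η) := by
  have := isProbabilityMeasure_expMeasure (r := totalRate A B a b L)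
    (by exact_mod_cast totalRate_pos A B a b L)
  unfold labelLaw ringChainLaw
  infer_instance

/-- The number of rings up to time `t`: the first `n` such that ring number `n+1` occurs after
`t`. -/
def ringCount (τ : ℕ → ℝ) (t : ℝ) : ℕ := sInf {n : ℕ | t < ∑ j ∈ Finset.range (n + 1), τ j}

/-- The label process `X_t`, in continuous time. -/
def labelProcess {L : ℕ+} {N : ℕ} (t : ℝ) (ω : (ℕ → ℝ) × (ℕ → Config L N)) : Config L N :=
  ω.2 (ringCount ω.1 t)

/-- `p_L(x_1, …, x_N; ε_1, …, ε_N)`: the probability that, for the label process started from `N`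
particles located at `x_1, …, x_N`, for each `i` the particle started at `x_i` hits `ε_i`. -/
def hitProb (A B : ℝ≥0) (a b : ℝ) (L : ℕ+) {N : ℕ} (x : Fin N → Chain L) (ε : Fin N → Reservoir) :
    ℝ :=
  (labelLaw A B a b L (fun i => Sum.inl (x i))).real
    {ω | ∀ i, ∃ t : ℝ, 0 ≤ t ∧ labelProcess t ω i = Sum.inr (ε i)}

end

noncomputable section

theorem integral_pow_mul_one_sub_pow (s t : ℕ) :
    ∫ p in (0 : ℝ)..1, p ^ s * (1 - p) ^ t =
      (s.factorial * t.factorial : ℝ) / (s + t + 1).factorial := by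
  induction t generalizing s with
  | zero =>
    have h1 : ((s : ℝ) + 1) ≠ 0 := by positivity
    have h2 : (s.factorial : ℝ) ≠ 0 := by positivity
    simp [Nat.factorial_succ]
    field_simp
  | succ t ih =>
    have hd : ∀ p ∈ Set.uIcc (0 : ℝ) 1, HasDerivAt (fun p : ℝ => p ^ (s + 1) * (1 - p) ^ (t + 1))
        (((s : ℝ) + 1) * (p ^ s * (1 - p) ^ (t + 1)) -
          ((t : ℝ) + 1) * (p ^ (s + 1) * (1 - p) ^ t)) p := by
      intro p _
      have h1 := (hasDerivAt_pow (s + 1) p).mul (((hasDerivAt_id p).const_sub 1).pow (t + 1))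
      refine h1.congr_deriv ?_
      simp only [Nat.cast_add, Nat.cast_one, Nat.add_sub_cancel, id, Pi.pow_apply]
      ring
    have hint : ∀ m n : ℕ, IntervalIntegrable (fun p : ℝ => p ^ m * (1 - p) ^ n) volume 0 1 :=
      fun m n => Continuous.intervalIntegrable (by fun_prop) _ _
    have key := intervalIntegral.integral_eq_sub_of_hasDerivAt hd
      (((hint _ _).const_mul _).sub ((hint _ _).const_mul _))
    rw [intervalIntegral.integral_sub ((hint _ _).const_mul _) ((hint _ _).const_mul _),
      intervalIntegral.integral_const_mul, intervalIntegral.integral_const_mul, ih (s + 1)] at key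
    have h1 : ((s : ℝ) + 1) ≠ 0 := by positivity
    have e : s + 1 + t + 1 = s + (t + 1) + 1 := by ring
    rw [e] at key
    simp only [one_pow, sub_self, ne_eq, Nat.add_eq_zero_iff, one_ne_zero, and_false,
      not_false_eq_true, zero_pow, mul_zero, zero_mul] at key
    have h3 : ((s : ℝ) + 1) * ∫ p in (0 : ℝ)..1, p ^ s * (1 - p) ^ (t + 1) =
        ((s : ℝ) + 1) * ((s.factorial * (t + 1).factorial : ℝ) / (s + (t + 1) + 1).factorial) := by
      rw [sub_eq_zero.1 key, Nat.factorial_succ s, Nat.factorial_succ t]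
      push_cast
      ring
    exact mul_left_cancel₀ h1 h3

open Finset in
theorem sum_prefix_eq {α : Type*} [Fintype α] [DecidableEq α] (G : Finset α → ℝ) :
    ∑ q : Fin (Fintype.card α + 1) × (Fin (Fintype.card α) ≃ α),
      G {i | (q.2.symm i : ℕ) < q.1} =
    ∑ S : Finset α, (S.card.factorial * (Fintype.card α - S.card).factorial : ℝ) * G S := by
  classical
  have hcard : ∀ (U : Fin (Fintype.card α + 1)) (ζ : Fin (Fintype.card α) ≃ α),
      (univ.filter fun i => (ζ.symm i : ℕ) < U).card = U := by
    intro U ζ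
    have : (univ.filter fun i => (ζ.symm i : ℕ) < U).card =
        (univ.filter fun j : Fin (Fintype.card α) => (j : ℕ) < U).card := by
      refine card_bij (fun i _ => ζ.symm i) ?_ ?_ ?_
      · intro i hi; simpa using hi
      · intro i _ j _ h; exact ζ.symm.injective h
      · intro j hj; exact ⟨ζ j, by simpa using hj, by simp⟩
    rw [this, Fin.card_filter_val_lt]
    have := U.2
    omega
  rw [← sum_fiberwise (s := univ)
    (g := fun q : Fin (Fintype.card α + 1) × (Fin (Fintype.card α) ≃ α) =>
      univ.filter fun i => (q.2.symm i : ℕ) < q.1)]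
  refine sum_congr rfl fun S _ => ?_
  have h1 : ∀ q ∈ univ.filter fun q : Fin (Fintype.card α + 1) × (Fin (Fintype.card α) ≃ α) =>
      (univ.filter fun i => (q.2.symm i : ℕ) < q.1) = S,
      G {i | (q.2.symm i : ℕ) < q.1} = G S := by
    intro q hq
    rw [(mem_filter.1 hq).2]
  rw [sum_congr rfl h1, sum_const, nsmul_eq_mul]
  congr 1
  rw [← Nat.cast_mul, ← Numbering.card_prefixed S]
  congr 1
  refine card_bij (fun q _ => q.2.symm) ?_ ?_ ?_
  · rintro ⟨U, ζ⟩ hq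
    have hq := (mem_filter.1 hq).2
    have hU := hcard U ζ
    simp only at hq
    rw [hq] at hU
    rw [Numbering.mem_prefixed]
    intro i
    rw [hU, ← hq]
    simp
  · rintro ⟨U, ζ⟩ hq ⟨U', ζ'⟩ hq' h
    have hq := (mem_filter.1 hq).2
    have hq' := (mem_filter.1 hq').2
    simp only at hq hq' h
    have hU := hcard U ζ
    have hU' := hcard U' ζ'
    rw [hq] at hU
    rw [hq'] at hU'
    have : ζ = ζ' := by
      rw [← ζ.symm_symm, h, ζ'.symm_symm]
    rw [this, Fin.ext (hU.symm.trans hU')]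
  · intro f hf
    rw [Numbering.mem_prefixed] at hf
    refine ⟨⟨⟨S.card, Nat.lt_succ_of_le (card_le_univ S)⟩, f.symm⟩, ?_, by simp⟩
    rw [mem_filter]
    refine ⟨mem_univ _, ?_⟩
    ext i
    simp [hf i]

/-- A uniform number of particles, in a uniform order, sent to one side is the same as a Bernoulli
choice of side for each particle, with a uniform success probability. -/
theorem average_prefix_prod {α : Type*} [Fintype α] [DecidableEq α] (f g : α → ℝ) :
    (∑ q : Fin (Fintype.card α + 1) × (Fin (Fintype.card α) ≃ α),
      ∏ i, (if (q.2.symm i : ℕ) < q.1 then f i else g i)) =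
    ((Fintype.card α + 1).factorial : ℝ) *
      ∫ p in (0 : ℝ)..1, ∏ i, (p * f i + (1 - p) * g i) := by
  classical
  have h := sum_prefix_eq (α := α) fun S => (∏ i ∈ S, f i) * ∏ i ∈ Finset.univ \ S, g i
  have hl : ∀ q : Fin (Fintype.card α + 1) × (Fin (Fintype.card α) ≃ α),
      ∏ i, (if (q.2.symm i : ℕ) < q.1 then f i else g i) =
      (∏ i ∈ Finset.univ.filter (fun i => (q.2.symm i : ℕ) < q.1), f i) *
        ∏ i ∈ Finset.univ \ Finset.univ.filter (fun i => (q.2.symm i : ℕ) < q.1), g i := by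
    intro q
    rw [Finset.prod_ite, ← Finset.filter_not]
  rw [Finset.sum_congr rfl fun q _ => hl q, h]
  have hr : ∀ p : ℝ, ∏ i, (p * f i + (1 - p) * g i) = ∑ S : Finset α,
      (p ^ S.card * (1 - p) ^ (Fintype.card α - S.card)) *
        ((∏ i ∈ S, f i) * ∏ i ∈ Finset.univ \ S, g i) := by
    intro p
    rw [Finset.prod_add, Finset.powerset_univ]
    refine Finset.sum_congr rfl fun S _ => ?_
    rw [Finset.prod_mul_distrib, Finset.prod_mul_distrib, Finset.prod_const, Finset.prod_const,
      Finset.card_sdiff_of_subset (Finset.subset_univ S), Finset.card_univ]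
    ring
  simp_rw [hr]
  rw [intervalIntegral.integral_finsetSum
    (fun S _ => Continuous.intervalIntegrable (by fun_prop) _ _), Finset.mul_sum]
  refine Finset.sum_congr rfl fun S _ => ?_
  rw [intervalIntegral.integral_mul_const, integral_pow_mul_one_sub_pow,
    Nat.add_sub_cancel' (Finset.card_le_univ S)]
  have : ((Fintype.card α + 1).factorial : ℝ) ≠ 0 := by positivity
  field_simp

/-- The mean of a function on a finite type. -/
def PMF.mean {α : Type*} [Fintype α] (μ : PMF α) (f : α → ℝ) : ℝ := ∑ x, (μ x).toReal * f x

theorem PMF.mean_bind {α β : Type*} [Fintype α] [Fintype β] (μ : PMF α) (κ : α → PMF β)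
    (f : β → ℝ) : (μ.bind κ).mean f = μ.mean fun x => (κ x).mean f := by
  have h : ∀ y, ((μ.bind κ) y).toReal = ∑ x, (μ x).toReal * (κ x y).toReal := by
    intro y
    rw [PMF.bind_apply, tsum_fintype, ENNReal.toReal_sum]
    · simp [ENNReal.toReal_mul]
    · intro x _
      exact ENNReal.mul_ne_top (PMF.apply_ne_top _ _) (PMF.apply_ne_top _ _)
  simp only [PMF.mean, h, Finset.sum_mul, Finset.mul_sum]
  rw [Finset.sum_comm]
  simp only [mul_assoc]

theorem PMF.mean_pure {α : Type*} [Fintype α] (x : α) (f : α → ℝ) :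
    (PMF.pure x).mean f = f x := by
  classical
  unfold PMF.mean
  rw [Finset.sum_eq_single x]
  · simp
  · intro y _ hy
    simp [PMF.pure_apply, hy]
  · simp

theorem PMF.mean_map {α β : Type*} [Fintype α] [Fintype β] (μ : PMF α) (g : α → β)
    (f : β → ℝ) : (μ.map g).mean f = μ.mean fun x => f (g x) := by
  rw [← PMF.bind_pure_comp, PMF.mean_bind]
  simp [PMF.mean_pure]

theorem PMF.mean_uniformOfFintype {α : Type*} [Fintype α] [Nonempty α] (f : α → ℝ) :
    (PMF.uniformOfFintype α).mean f = (Fintype.card α : ℝ)⁻¹ * ∑ x, f x := by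
  simp [PMF.mean, Finset.mul_sum]

theorem PMF.integral_toMeasure_eq_mean {α : Type*} [Fintype α] [MeasurableSpace α]
    [MeasurableSingletonClass α] (μ : PMF α) (f : α → ℝ) :
    ∫ x, f x ∂μ.toMeasure = μ.mean f := by
  rw [PMF.integral_eq_sum]
  simp [PMF.mean]

/-- The transition operator of one particle when a clock rings, given the fraction `p`: at a bond,
the particle goes to the left site with probability `p`. -/
def siteOp {L : ℕ+} : Clock L → ℝ → (Site L → ℝ) → Site L → ℝ
  | Sum.inl k, p, f, x =>
      if x = bondLeft k ∨ x = bondRight k then p * f (bondLeft k) + (1 - p) * f (bondRight k)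
      else f x
  | Sum.inr s, _, f, x => if x = boundarySite L s then f (Sum.inr s) else f x

theorem continuous_siteOp {L : ℕ+} (e : Clock L) (f : Site L → ℝ) (x : Site L) :
    Continuous fun p => siteOp e p f x := by
  rcases e with k | s
  · simp only [siteOp]
    split_ifs <;> fun_prop
  · simp only [siteOp]
    fun_prop

/-- The transition operator of the configuration when a given clock rings. -/
def clockOp {L : ℕ+} {N : ℕ} (e : Clock L) (f : Config L N → ℝ) (η : Config L N) : ℝ :=
  (ringUpdate η e).mean f

theorem clockOp_prod {L : ℕ+} {N : ℕ} (e : Clock L) (f : Fin N → Site L → ℝ) (η : Config L N) :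
    clockOp e (fun η => ∏ i, f i (η i)) η = ∫ p in (0 : ℝ)..1, ∏ i, siteOp e p (f i) (η i) := by
  classical
  rcases e with k | s
  · have hq : ∀ q : Fin (Fintype.card (bondLabels k η) + 1) ×
        (Fin (Fintype.card (bondLabels k η)) ≃ bondLabels k η),
        ∏ i, f i (redistribute k η q.1 q.2 i) =
        (∏ i : bondLabels k η,
          (if (q.2.symm i : ℕ) < q.1 then f i (bondLeft k) else f i (bondRight k))) *
          ∏ i : {i // ¬(η i = bondLeft k ∨ η i = bondRight k)}, f i (η i) := by
      intro q
      rw [← Fintype.prod_subtype_mul_prod_subtype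
        (fun i => η i = bondLeft k ∨ η i = bondRight k)]
      congr 1
      · refine Finset.prod_congr rfl fun i _ => ?_
        simp only [redistribute, dif_pos i.2]
        split_ifs <;> rfl
      · refine Finset.prod_congr rfl fun i _ => ?_
        simp only [redistribute, dif_neg i.2]
    have hp : ∀ p : ℝ, ∏ i, siteOp (Sum.inl k) p (f i) (η i) =
        (∏ i : bondLabels k η, (p * f i (bondLeft k) + (1 - p) * f i (bondRight k))) *
          ∏ i : {i // ¬(η i = bondLeft k ∨ η i = bondRight k)}, f i (η i) := by
      intro p
      rw [← Fintype.prod_subtype_mul_prod_subtype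
        (fun i => η i = bondLeft k ∨ η i = bondRight k)]
      congr 1
      · refine Finset.prod_congr rfl fun i _ => ?_
        simp only [siteOp, if_pos i.2]
      · refine Finset.prod_congr rfl fun i _ => ?_
        simp only [siteOp, if_neg i.2]
    simp only [clockOp, ringUpdate, PMF.mean_map, PMF.mean_uniformOfFintype, hq, hp]
    rw [← Finset.sum_mul, average_prefix_prod, intervalIntegral.integral_mul_const,
      Fintype.card_prod, Fintype.card_fin, Fintype.card_equiv (Fintype.equivFin _).symm,
      Fintype.card_fin, ← Nat.factorial_succ, ← mul_assoc, ← mul_assoc, inv_mul_cancel₀, one_mul]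
    positivity
  · simp only [clockOp, ringUpdate, PMF.mean_pure, siteOp]
    simp only [intervalIntegral.integral_const, sub_zero, one_smul]
    refine Finset.prod_congr rfl fun i _ => ?_
    split_ifs <;> rfl

/-- The generator of the label process. -/
def labelGen (A B : ℝ≥0) (a b : ℝ) (L : ℕ+) {N : ℕ} (f : Config L N → ℝ) (η : Config L N) : ℝ :=
  ∑ e, (clockRate A B a b L e : ℝ) * (clockOp e f η - f η)

/-- The transition operator of the configuration from one ring of the clocks to the next one. -/
def ringOp (A B : ℝ≥0) (a b : ℝ) (L : ℕ+) {N : ℕ} (f : Config L N → ℝ) (η : Config L N) : ℝ :=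
  ((ringingClock A B a b L).bind (ringUpdate η)).mean f

theorem ringingClock_toReal (A B : ℝ≥0) (a b : ℝ) (L : ℕ+) (e : Clock L) :
    (ringingClock A B a b L e).toReal =
      (clockRate A B a b L e : ℝ) * (totalRate A B a b L : ℝ)⁻¹ := by
  rw [ringingClock, PMF.normalize_apply, tsum_clockRate]
  simp

theorem coe_totalRate (A B : ℝ≥0) (a b : ℝ) (L : ℕ+) :
    (totalRate A B a b L : ℝ) = ∑ e, (clockRate A B a b L e : ℝ) := by
  simp [totalRate]

theorem ringOp_eq (A B : ℝ≥0) (a b : ℝ) (L : ℕ+) {N : ℕ} (f : Config L N → ℝ) (η : Config L N) :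
    ringOp A B a b L f η =
      f η + (totalRate A B a b L : ℝ)⁻¹ * labelGen A B a b L f η := by
  have hΛ : (totalRate A B a b L : ℝ) ≠ 0 := by exact_mod_cast (totalRate_pos A B a b L).ne'
  rw [ringOp, PMF.mean_bind, PMF.mean]
  simp only [ringingClock_toReal, labelGen, mul_sub, Finset.sum_sub_distrib, ← Finset.sum_mul,
    ← coe_totalRate]
  rw [← mul_assoc, inv_mul_cancel₀ hΛ, Finset.mul_sum]
  simp only [clockOp]
  rw [one_mul, add_sub_cancel]
  exact Finset.sum_congr rfl fun e _ => by ring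

theorem integral_ringKernel (A B : ℝ≥0) (a b : ℝ) (L : ℕ+) {N : ℕ} (f : Config L N → ℝ)
    (η : Config L N) : ∫ ξ, f ξ ∂(ringKernel A B a b L N η) = ringOp A B a b L f η :=
  PMF.integral_toMeasure_eq_mean _ _

instance (A B : ℝ≥0) (a b : ℝ) (L : ℕ+) {N : ℕ} (η : Config L N) :
    IsProbabilityMeasure (ringChainLaw A B a b L η) := by
  unfold ringChainLaw
  infer_instance

theorem ringChainLaw_map_zero (A B : ℝ≥0) (a b : ℝ) (L : ℕ+) {N : ℕ} (η : Config L N) :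
    (ringChainLaw A B a b L η).map (fun ω => ω 0) = Measure.dirac η := by
  have h : (fun ω : ℕ → Config L N => ω 0) =
      (fun h : (i : Finset.Iic 0) → Config L N => h ⟨0, by simp⟩) ∘
        Preorder.frestrictLe (π := fun _ => Config L N) 0 := rfl
  rw [h, ← Measure.map_map (by fun_prop) (by fun_prop), ringChainLaw, Kernel.trajMeasure,
    Measure.map_comp _ _ (by fun_prop), Kernel.traj_map_frestrictLe, Kernel.partialTraj_self,
    Measure.id_comp, Measure.map_map (by fun_prop) (by fun_prop)]
  rw [Measure.map_dirac]
  · rfl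

theorem ringChainLaw_compProd (A B : ℝ≥0) (a b : ℝ) (L : ℕ+) {N : ℕ} (η : Config L N) (n : ℕ) :
    ((ringChainLaw A B a b L η).map fun ω => ω n) ⊗ₘ ringKernel A B a b L N =
      (ringChainLaw A B a b L η).map fun ω => (ω n, ω (n + 1)) := by
  have h := Kernel.map_frestrictLe_trajMeasure_compProd_eq_map_trajMeasure
    (X := fun _ => Config L N) (μ₀ := Measure.dirac η)
    (κ := fun n => (ringKernel A B a b L N).comap (fun h => h ⟨n, Finset.mem_Iic.2 le_rfl⟩)
      (measurable_pi_apply _)) (a := n)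
  have h2 := congrArg (Measure.map (Prod.map
    (fun h : (i : Finset.Iic n) → Config L N => h ⟨n, Finset.mem_Iic.2 le_rfl⟩) id)) h
  rw [Measure.map_map (by fun_prop) (by fun_prop)] at h2
  refine Eq.trans ?_ h2
  rw [← ringChainLaw]
  ext s hs
  rw [Measure.map_apply (by fun_prop) hs, Measure.compProd_apply hs, Measure.compProd_apply
    ((by fun_prop : Measurable (Prod.map
    (fun h : (i : Finset.Iic n) → Config L N => h ⟨n, Finset.mem_Iic.2 le_rfl⟩) id)) hs),
    lintegral_map (Kernel.measurable_kernel_prodMk_left hs) (by fun_prop),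
    lintegral_map (Kernel.measurable_kernel_prodMk_left
     ((by fun_prop : Measurable (Prod.map
    (fun h : (i : Finset.Iic n) → Config L N => h ⟨n, Finset.mem_Iic.2 le_rfl⟩) id)) hs))
     (by fun_prop)]
  rfl

theorem integral_ringChainLaw (A B : ℝ≥0) (a b : ℝ) (L : ℕ+) {N : ℕ} (η : Config L N) (n : ℕ)
    (f : Config L N → ℝ) :
    ∫ ω, f (ω n) ∂(ringChainLaw A B a b L η) = ((ringOp A B a b L)^[n] f) η := by
  induction n generalizing f with
  | zero =>
    have := integral_map (μ := ringChainLaw A B a b L η) (φ := fun ω => ω 0) (f := f)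
      (measurable_pi_apply 0).aemeasurable
      (measurable_of_finite f).aestronglyMeasurable
    rw [← this, ringChainLaw_map_zero, integral_dirac]
    rfl
  | succ n ih =>
    rw [Function.iterate_succ_apply, ← ih]
    have h1 := integral_map (μ := ringChainLaw A B a b L η) (φ := fun ω => (ω n, ω (n + 1)))
      (f := fun z : Config L N × Config L N => f z.2) (by fun_prop)
      ((measurable_of_finite f).comp measurable_snd).aestronglyMeasurable
    have h2 := integral_map (μ := ringChainLaw A B a b L η) (φ := fun ω => ω n)
      (f := ringOp A B a b L f) (measurable_pi_apply n).aemeasurable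
      (measurable_of_finite _).aestronglyMeasurable
    have hp : IsProbabilityMeasure ((ringChainLaw A B a b L η).map fun ω => ω n) :=
      Measure.isProbabilityMeasure_map (measurable_pi_apply n).aemeasurable
    rw [← h1, ← h2, ← ringChainLaw_compProd, Measure.integral_compProd]
    · simp only [integral_ringKernel]
    · exact Integrable.of_finite

theorem ringUpdate_absorbed {L : ℕ+} {N : ℕ} {η ξ : Config L N} {e : Clock L}
    (h : ξ ∈ (ringUpdate η e).support) {i : Fin N} {s : Reservoir} (hi : η i = Sum.inr s) :
    ξ i = Sum.inr s := by
  rcases e with k | r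
  · simp only [ringUpdate, PMF.mem_support_map_iff] at h
    obtain ⟨q, _, rfl⟩ := h
    simp [redistribute, hi, bondLeft, bondRight]
  · simp only [ringUpdate, PMF.support_pure, Set.mem_singleton_iff] at h
    subst h
    cases r <;> simp [hi, boundarySite]

theorem ae_absorbed_step (A B : ℝ≥0) (a b : ℝ) (L : ℕ+) {N : ℕ} (η : Config L N) (n : ℕ) :
    ∀ᵐ ω ∂(ringChainLaw A B a b L η), ∀ (i : Fin N) (s : Reservoir),
      ω n i = Sum.inr s → ω (n + 1) i = Sum.inr s := by
  let S : Set (Config L N × Config L N) :=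
    {z | ∀ (i : Fin N) (s : Reservoir), z.1 i = Sum.inr s → z.2 i = Sum.inr s}
  have hS : MeasurableSet S := S.toFinite.measurableSet
  have h : ∀ᵐ z ∂((ringChainLaw A B a b L η).map fun ω => (ω n, ω (n + 1))), z ∈ S := by
    have hp : IsProbabilityMeasure ((ringChainLaw A B a b L η).map fun ω => ω n) :=
      Measure.isProbabilityMeasure_map (measurable_pi_apply n).aemeasurable
    rw [← ringChainLaw_compProd, ae_iff, ← Set.compl_def, Measure.compProd_apply hS.compl,
      lintegral_eq_zero_iff (Kernel.measurable_kernel_prodMk_left hS.compl)]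
    refine Eventually.of_forall fun η' => ?_
    change (((ringingClock A B a b L).bind (ringUpdate η')).toMeasure) _ = 0
    rw [PMF.toMeasure_apply_eq_zero_iff _ (Set.toFinite _).measurableSet, Set.disjoint_left]
    intro ξ hξ hmem
    apply hmem
    intro i s hi
    rw [PMF.mem_support_bind_iff] at hξ
    obtain ⟨e, _, he⟩ := hξ
    exact ringUpdate_absorbed he hi
  exact ae_of_ae_map (by fun_prop) h

theorem ae_absorbed (A B : ℝ≥0) (a b : ℝ) (L : ℕ+) {N : ℕ} (η : Config L N) :
    ∀ᵐ ω ∂(ringChainLaw A B a b L η), ∀ (m n : ℕ) (i : Fin N) (s : Reservoir), m ≤ n →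
      ω m i = Sum.inr s → ω n i = Sum.inr s := by
  filter_upwards [ae_all_iff.2 (ae_absorbed_step A B a b L η)] with ω hω m n i s hmn h
  induction n, hmn using Nat.le_induction with
  | base => exact h
  | succ n _ ih => exact hω n i s ih

theorem expMeasure_ae_pos {r : ℝ} (hr : 0 < r) : ∀ᵐ t ∂(expMeasure r), 0 < t := by
  have := isProbabilityMeasure_expMeasure hr
  have h := cdf_expMeasure_eq hr 0
  rw [cdf_eq_real] at h
  simp only [le_refl, if_true, mul_zero, neg_zero, Real.exp_zero, sub_self] at h
  rw [ae_iff]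
  have h0 : {t : ℝ | ¬ 0 < t} = Set.Iic 0 := by ext; simp
  rw [h0]
  exact (measureReal_eq_zero_iff).1 h

theorem ringCount_sum {τ : ℕ → ℝ} (hτ : ∀ j, 0 < τ j) (n : ℕ) :
    ringCount τ (∑ j ∈ Finset.range n, τ j) = n := by
  have hn : n ∈ {m : ℕ | ∑ j ∈ Finset.range n, τ j < ∑ j ∈ Finset.range (m + 1), τ j} := by
    simp [Finset.sum_range_succ, hτ]
  apply le_antisymm (Nat.sInf_le hn)
  apply le_csInf ⟨n, hn⟩
  intro m hm
  by_contra! hlt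
  have : ∑ j ∈ Finset.range (m + 1), τ j ≤ ∑ j ∈ Finset.range n, τ j :=
    Finset.sum_le_sum_of_subset_of_nonneg (Finset.range_subset_range.2 hlt)
      fun j _ _ => (hτ j).le
  exact absurd (lt_of_lt_of_le hm this) (lt_irrefl _)

theorem hitProb_eq_ringChainLaw (A B : ℝ≥0) (a b : ℝ) (L : ℕ+) {N : ℕ} (x : Fin N → Chain L)
    (ε : Fin N → Reservoir) :
    hitProb A B a b L x ε = (ringChainLaw A B a b L (fun i => Sum.inl (x i))).real
      {ω | ∃ n, ω n = fun i => Sum.inr (ε i)} := by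
  set η : Config L N := fun i => Sum.inl (x i)
  have hΛ : (0 : ℝ) < totalRate A B a b L := by exact_mod_cast totalRate_pos A B a b L
  have := isProbabilityMeasure_expMeasure hΛ
  have h1 : ∀ᵐ ω ∂(labelLaw A B a b L η), ∀ j, 0 < ω.1 j := by
    rw [ae_all_iff]
    intro j
    have hq : Measure.QuasiMeasurePreserving (fun ω : (ℕ → ℝ) × (ℕ → Config L N) => ω.1 j)
        (labelLaw A B a b L η) (expMeasure (totalRate A B a b L)) :=
      (measurePreserving_eval_infinitePi
        (fun _ : ℕ => expMeasure (totalRate A B a b L)) j).quasiMeasurePreserving.comp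
        Measure.quasiMeasurePreserving_fst
    exact hq.ae (expMeasure_ae_pos hΛ)
  have h2 : ∀ᵐ ω ∂(labelLaw A B a b L η), ∀ (m n : ℕ) (i : Fin N) (s : Reservoir), m ≤ n →
      ω.2 m i = Sum.inr s → ω.2 n i = Sum.inr s :=
    Measure.quasiMeasurePreserving_snd.ae (ae_absorbed A B a b L η)
  have h3 : {ω : (ℕ → ℝ) × (ℕ → Config L N) |
      ∀ i, ∃ t : ℝ, 0 ≤ t ∧ labelProcess t ω i = Sum.inr (ε i)} =ᵐ[labelLaw A B a b L η]
      (Set.univ ×ˢ {ω : ℕ → Config L N | ∃ n, ω n = fun i => Sum.inr (ε i)} :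
        Set ((ℕ → ℝ) × (ℕ → Config L N))) := by
    filter_upwards [h1, h2] with ω hpos habs
    apply propext
    constructor
    · intro h
      choose t _ ht using (h : ∀ i, ∃ t : ℝ, 0 ≤ t ∧ labelProcess t ω i = Sum.inr (ε i))
      refine ⟨trivial, Finset.univ.sup fun i => ringCount ω.1 (t i), ?_⟩
      funext i
      exact habs _ _ i _ (Finset.le_sup (f := fun i => ringCount ω.1 (t i)) (Finset.mem_univ i))
        (ht i)
    · rintro ⟨-, n, hn⟩ i
      refine ⟨∑ j ∈ Finset.range n, ω.1 j, Finset.sum_nonneg fun j _ => (hpos j).le, ?_⟩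
      rw [labelProcess, ringCount_sum hpos, hn]
  rw [hitProb, measureReal_congr h3, labelLaw, measureReal_prod_prod]
  simp

/-- The indicator function of the absorption of the particles at prescribed reservoirs. -/
def absorbedAt {L : ℕ+} {N : ℕ} (ε : Fin N → Reservoir) (η : Config L N) : ℝ :=
  if η = fun i => Sum.inr (ε i) then 1 else 0

theorem tendsto_ringOp_absorbedAt (A B : ℝ≥0) (a b : ℝ) (L : ℕ+) {N : ℕ} (x : Fin N → Chain L)
    (ε : Fin N → Reservoir) :
    Tendsto (fun n => ((ringOp A B a b L)^[n] (absorbedAt ε)) fun i => Sum.inl (x i)) atTop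
      (nhds (hitProb A B a b L x ε)) := by
  set η : Config L N := fun i => Sum.inl (x i) with hη
  have hS : ∀ n, MeasurableSet {ω : ℕ → Config L N | ω n = fun i => Sum.inr (ε i)} := fun n =>
    measurableSet_eq_fun (by fun_prop) measurable_const
  have h1 : ∀ n, ((ringOp A B a b L)^[n] (absorbedAt ε)) η = (ringChainLaw A B a b L η).real
      {ω | ∃ m, m ≤ n ∧ ω m = fun i => Sum.inr (ε i)} := by
    intro n
    have h2 : ({ω | ∃ m, m ≤ n ∧ ω m = fun i => Sum.inr (ε i)} : Set (ℕ → Config L N))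
        =ᵐ[ringChainLaw A B a b L η] {ω | ω n = fun i => Sum.inr (ε i)} := by
      filter_upwards [ae_absorbed A B a b L η] with ω hω
      apply propext
      constructor
      · rintro ⟨m, hm, h⟩
        funext i
        exact hω m n i _ hm (congrFun h i)
      · intro h
        exact ⟨n, le_rfl, h⟩
    rw [measureReal_congr h2, ← integral_ringChainLaw, ← integral_indicator_one (hS n)]
    refine integral_congr_ae (Eventually.of_forall fun ω => ?_)
    simp [absorbedAt, Set.indicator_apply]
  simp only [h1]
  rw [hitProb_eq_ringChainLaw, ← hη]
  have h3 : {ω : ℕ → Config L N | ∃ n, ω n = fun i => Sum.inr (ε i)} =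
      ⋃ n, {ω | ∃ m, m ≤ n ∧ ω m = fun i => Sum.inr (ε i)} := by
    ext ω
    simp only [Set.mem_ofPred_eq, Set.mem_iUnion]
    exact ⟨fun ⟨n, h⟩ => ⟨n, n, le_rfl, h⟩, fun ⟨_, m, _, h⟩ => ⟨m, h⟩⟩
  rw [h3]
  have hmono : Monotone fun n : ℕ =>
      {ω : ℕ → Config L N | ∃ m, m ≤ n ∧ ω m = fun i => Sum.inr (ε i)} :=
    fun n n' hn ω ⟨m, hm, h⟩ => ⟨m, hm.trans hn, h⟩
  exact (ENNReal.tendsto_toReal (measure_ne_top _ _)).comp (tendsto_measure_iUnion_atTop hmono)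

theorem siteOp_eq_sum {L : ℕ+} (e : Clock L) (p : ℝ) (f : Site L → ℝ) (x : Site L) :
    siteOp e p f x = ∑ s, siteOp e p (Pi.single s 1) x * f s := by
  rcases e with k | s
  · simp only [siteOp]
    split_ifs
    · simp only [add_mul, Finset.sum_add_distrib, mul_assoc, ← Finset.mul_sum]
      simp [Pi.single_apply]
    · simp [Pi.single_apply]
  · simp only [siteOp]
    split_ifs <;> simp [Pi.single_apply]

theorem siteOp_const {L : ℕ+} (e : Clock L) (p c : ℝ) (x : Site L) :
    siteOp e p (fun _ => c) x = c := by
  rcases e with k | s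
  · simp only [siteOp]
    split_ifs
    · ring
    · rfl
  · simp [siteOp]

theorem siteOp_add {L : ℕ+} (e : Clock L) (p : ℝ) (f g : Site L → ℝ) (x : Site L) :
    siteOp e p (fun u => f u + g u) x = siteOp e p f x + siteOp e p g x := by
  rcases e with k | s <;> simp only [siteOp] <;> split_ifs <;> ring

theorem siteOp_sub {L : ℕ+} (e : Clock L) (p : ℝ) (f g : Site L → ℝ) (x : Site L) :
    siteOp e p (fun u => f u - g u) x = siteOp e p f x - siteOp e p g x := by
  rcases e with k | s <;> simp only [siteOp] <;> split_ifs <;> ring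

theorem siteOp_const_mul {L : ℕ+} (e : Clock L) (p c : ℝ) (f : Site L → ℝ) (x : Site L) :
    siteOp e p (fun u => c * f u) x = c * siteOp e p f x := by
  rcases e with k | s <;> simp only [siteOp] <;> split_ifs <;> ring

theorem siteOp_mono {L : ℕ+} (e : Clock L) {p : ℝ} (hp : p ∈ Set.Icc (0 : ℝ) 1)
    {f g : Site L → ℝ} (h : ∀ u, f u ≤ g u) (x : Site L) : siteOp e p f x ≤ siteOp e p g x := by
  rcases e with k | s <;> simp only [siteOp] <;> split_ifs
  · have h1 := sub_nonneg.2 hp.2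
    have h2 := hp.1
    gcongr <;> apply h
  all_goals apply h

/-- The mean of `siteOp`: the transition operator of one particle when a clock rings. -/
def oneOp {L : ℕ+} (e : Clock L) (f : Site L → ℝ) (x : Site L) : ℝ :=
  ∫ p in (0 : ℝ)..1, siteOp e p f x

/-- The transition operator of two particles for a given fraction `p`. -/
def pairSiteOp {L : ℕ+} (e : Clock L) (p : ℝ) (φ : Site L → Site L → ℝ) (x y : Site L) : ℝ :=
  siteOp e p (fun u => siteOp e p (φ u) y) x

/-- The transition operator of two particles when a clock rings. -/
def pairOp {L : ℕ+} (e : Clock L) (φ : Site L → Site L → ℝ) (x y : Site L) : ℝ :=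
  ∫ p in (0 : ℝ)..1, pairSiteOp e p φ x y

theorem pairSiteOp_mul {L : ℕ+} (e : Clock L) (p : ℝ) (f g : Site L → ℝ) (x y : Site L) :
    pairSiteOp e p (fun u v => f u * g v) x y = siteOp e p f x * siteOp e p g y := by
  simp only [pairSiteOp, siteOp_const_mul]
  simp only [mul_comm _ (siteOp e p g y), siteOp_const_mul]

theorem pairSiteOp_eq_sum {L : ℕ+} (e : Clock L) (p : ℝ) (φ : Site L → Site L → ℝ)
    (x y : Site L) : pairSiteOp e p φ x y =
      ∑ s, siteOp e p (Pi.single s 1) x * siteOp e p (φ s) y := by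
  rw [pairSiteOp, siteOp_eq_sum]

theorem continuous_pairSiteOp {L : ℕ+} (e : Clock L) (φ : Site L → Site L → ℝ) (x y : Site L) :
    Continuous fun p => pairSiteOp e p φ x y := by
  simp only [pairSiteOp_eq_sum]
  exact continuous_finsetSum _ fun s _ => (continuous_siteOp _ _ _).mul (continuous_siteOp _ _ _)

theorem pairSiteOp_mono {L : ℕ+} (e : Clock L) {p : ℝ} (hp : p ∈ Set.Icc (0 : ℝ) 1)
    {φ ψ : Site L → Site L → ℝ} (h : ∀ u v, φ u v ≤ ψ u v) (x y : Site L) :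
    pairSiteOp e p φ x y ≤ pairSiteOp e p ψ x y :=
  siteOp_mono e hp (fun u => siteOp_mono e hp (h u) y) x

theorem pairOp_mono {L : ℕ+} (e : Clock L) {φ ψ : Site L → Site L → ℝ}
    (h : ∀ u v, φ u v ≤ ψ u v) (x y : Site L) : pairOp e φ x y ≤ pairOp e ψ x y :=
  intervalIntegral.integral_mono_on zero_le_one
    ((continuous_pairSiteOp _ _ _ _).intervalIntegrable _ _)
    ((continuous_pairSiteOp _ _ _ _).intervalIntegrable _ _)
    fun _ hp => pairSiteOp_mono e hp h x y

theorem pairOp_add {L : ℕ+} (e : Clock L) (φ ψ : Site L → Site L → ℝ) (x y : Site L) :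
    pairOp e (fun u v => φ u v + ψ u v) x y = pairOp e φ x y + pairOp e ψ x y := by
  rw [pairOp, pairOp, pairOp, ← intervalIntegral.integral_add
    ((continuous_pairSiteOp _ _ _ _).intervalIntegrable _ _)
    ((continuous_pairSiteOp _ _ _ _).intervalIntegrable _ _)]
  simp only [pairSiteOp, siteOp_add]

theorem pairOp_sub {L : ℕ+} (e : Clock L) (φ ψ : Site L → Site L → ℝ) (x y : Site L) :
    pairOp e (fun u v => φ u v - ψ u v) x y = pairOp e φ x y - pairOp e ψ x y := by
  rw [pairOp, pairOp, pairOp, ← intervalIntegral.integral_sub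
    ((continuous_pairSiteOp _ _ _ _).intervalIntegrable _ _)
    ((continuous_pairSiteOp _ _ _ _).intervalIntegrable _ _)]
  simp only [pairSiteOp, siteOp_sub]

theorem pairOp_const_mul {L : ℕ+} (e : Clock L) (c : ℝ) (φ : Site L → Site L → ℝ)
    (x y : Site L) : pairOp e (fun u v => c * φ u v) x y = c * pairOp e φ x y := by
  rw [pairOp, pairOp, ← intervalIntegral.integral_const_mul]
  simp only [pairSiteOp, siteOp_const_mul]

theorem clockOp_finsetSum {L : ℕ+} {N : ℕ} {ι : Type*} (e : Clock L) (s : Finset ι)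
    (f : ι → Config L N → ℝ) (η : Config L N) :
    clockOp e (fun ξ => ∑ i ∈ s, f i ξ) η = ∑ i ∈ s, clockOp e (f i) η := by
  simp only [clockOp, PMF.mean, Finset.mul_sum]
  exact Finset.sum_comm

theorem clockOp_coord {L : ℕ+} {N : ℕ} (e : Clock L) (f : Site L → ℝ) (i : Fin N)
    (η : Config L N) : clockOp e (fun ξ => f (ξ i)) η = oneOp e f (η i) := by
  have h := clockOp_prod e (fun l => if l = i then f else fun _ => 1) η
  have h1 : ∀ ξ : Config L N, ∏ l, (if l = i then f else fun _ => 1) (ξ l) = f (ξ i) := by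
    intro ξ
    rw [Finset.prod_eq_single i]
    · simp
    · intro l _ hl; simp [hl]
    · simp
  have h2 : ∀ p, ∏ l, siteOp e p (if l = i then f else fun _ => 1) (η l) =
      siteOp e p f (η i) := by
    intro p
    rw [Finset.prod_eq_single i]
    · simp
    · intro l _ hl; simp [hl, siteOp_const]
    · simp
  simp only [h1, h2] at h
  exact h

theorem clockOp_coord_mul {L : ℕ+} {N : ℕ} (e : Clock L) (f g : Site L → ℝ) {i j : Fin N}
    (hij : i ≠ j) (η : Config L N) : clockOp e (fun ξ => f (ξ i) * g (ξ j)) η =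
      ∫ p in (0 : ℝ)..1, siteOp e p f (η i) * siteOp e p g (η j) := by
  have h := clockOp_prod e (fun l => if l = i then f else if l = j then g else fun _ => 1) η
  have h1 : ∀ ξ : Config L N,
      ∏ l, (if l = i then f else if l = j then g else fun _ => 1) (ξ l) = f (ξ i) * g (ξ j) := by
    intro ξ
    rw [Finset.prod_eq_mul i j hij]
    · simp [hij.symm]
    · intro l _ hl; simp [hl.1, hl.2]
    · simp
    · simp
  have h2 : ∀ p, ∏ l, siteOp e p (if l = i then f else if l = j then g else fun _ => 1) (η l) =
      siteOp e p f (η i) * siteOp e p g (η j) := by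
    intro p
    rw [Finset.prod_eq_mul i j hij]
    · simp [hij.symm]
    · intro l _ hl; simp [hl.1, hl.2, siteOp_const]
    · simp
    · simp
  simp only [h1, h2] at h
  exact h

theorem clockOp_pair {L : ℕ+} {N : ℕ} (e : Clock L) (φ : Site L → Site L → ℝ) {i j : Fin N}
    (hij : i ≠ j) (η : Config L N) :
    clockOp e (fun ξ => φ (ξ i) (ξ j)) η = pairOp e φ (η i) (η j) := by
  have h : ∀ ξ : Config L N, φ (ξ i) (ξ j) =
      ∑ s, (Pi.single s (1 : ℝ) : Site L → ℝ) (ξ i) * φ s (ξ j) := by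
    intro ξ; simp [Pi.single_apply]
  simp only [h]
  rw [clockOp_finsetSum]
  simp only [clockOp_coord_mul e _ _ hij, pairOp, pairSiteOp_eq_sum]
  rw [intervalIntegral.integral_finsetSum]
  intro s _
  exact ((continuous_siteOp _ _ _).mul (continuous_siteOp _ _ _)).intervalIntegrable _ _

/-- The generator of one particle. -/
def siteGen (A B : ℝ≥0) (a b : ℝ) (L : ℕ+) (f : Site L → ℝ) (x : Site L) : ℝ :=
  ∑ e, (clockRate A B a b L e : ℝ) * (oneOp e f x - f x)

/-- The generator of two particles. -/
def pairGen (A B : ℝ≥0) (a b : ℝ) (L : ℕ+) (φ : Site L → Site L → ℝ) (x y : Site L) : ℝ :=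
  ∑ e, (clockRate A B a b L e : ℝ) * (pairOp e φ x y - φ x y)

theorem labelGen_coord (A B : ℝ≥0) (a b : ℝ) (L : ℕ+) {N : ℕ} (f : Site L → ℝ) (i : Fin N)
    (η : Config L N) : labelGen A B a b L (fun ξ => f (ξ i)) η = siteGen A B a b L f (η i) := by
  simp only [labelGen, siteGen, clockOp_coord]

theorem labelGen_pair (A B : ℝ≥0) (a b : ℝ) (L : ℕ+) {N : ℕ} (φ : Site L → Site L → ℝ)
    {i j : Fin N} (hij : i ≠ j) (η : Config L N) :
    labelGen A B a b L (fun ξ => φ (ξ i) (ξ j)) η = pairGen A B a b L φ (η i) (η j) := by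
  simp only [labelGen, pairGen, clockOp_pair _ φ hij]

theorem labelGen_finsetSum (A B : ℝ≥0) (a b : ℝ) (L : ℕ+) {N : ℕ} {ι : Type*} (s : Finset ι)
    (f : ι → Config L N → ℝ) (η : Config L N) :
    labelGen A B a b L (fun ξ => ∑ i ∈ s, f i ξ) η = ∑ i ∈ s, labelGen A B a b L (f i) η := by
  simp only [labelGen, clockOp_finsetSum, ← Finset.sum_sub_distrib, Finset.mul_sum]
  exact Finset.sum_comm

theorem labelGen_add (A B : ℝ≥0) (a b : ℝ) (L : ℕ+) {N : ℕ} (f g : Config L N → ℝ)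
    (η : Config L N) : labelGen A B a b L (fun ξ => f ξ + g ξ) η =
      labelGen A B a b L f η + labelGen A B a b L g η := by
  simp only [labelGen, ← Finset.sum_add_distrib]
  refine Finset.sum_congr rfl fun e _ => ?_
  simp only [clockOp, PMF.mean, mul_add, Finset.sum_add_distrib]
  ring

theorem labelGen_neg (A B : ℝ≥0) (a b : ℝ) (L : ℕ+) {N : ℕ} (f : Config L N → ℝ)
    (η : Config L N) : labelGen A B a b L (fun ξ => -f ξ) η = -labelGen A B a b L f η := by
  simp only [labelGen, ← Finset.sum_neg_distrib]
  refine Finset.sum_congr rfl fun e _ => ?_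
  simp only [clockOp, PMF.mean, mul_neg, Finset.sum_neg_distrib]
  ring

theorem pairGen_add (A B : ℝ≥0) (a b : ℝ) (L : ℕ+) (φ ψ : Site L → Site L → ℝ) (x y : Site L) :
    pairGen A B a b L (fun u v => φ u v + ψ u v) x y =
      pairGen A B a b L φ x y + pairGen A B a b L ψ x y := by
  simp only [pairGen, ← Finset.sum_add_distrib, pairOp_add]
  exact Finset.sum_congr rfl fun e _ => by ring

theorem pairGen_sub (A B : ℝ≥0) (a b : ℝ) (L : ℕ+) (φ ψ : Site L → Site L → ℝ) (x y : Site L) :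
    pairGen A B a b L (fun u v => φ u v - ψ u v) x y =
      pairGen A B a b L φ x y - pairGen A B a b L ψ x y := by
  simp only [pairGen, ← Finset.sum_sub_distrib, pairOp_sub]
  exact Finset.sum_congr rfl fun e _ => by ring

theorem pairGen_const_mul (A B : ℝ≥0) (a b : ℝ) (L : ℕ+) (c : ℝ) (φ : Site L → Site L → ℝ)
    (x y : Site L) : pairGen A B a b L (fun u v => c * φ u v) x y =
      c * pairGen A B a b L φ x y := by
  simp only [pairGen, Finset.mul_sum, pairOp_const_mul]
  exact Finset.sum_congr rfl fun e _ => by ring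

theorem ringOp_iterate_mono (A B : ℝ≥0) (a b : ℝ) (L : ℕ+) {N : ℕ} {f g : Config L N → ℝ}
    (h : ∀ η, f η ≤ g η) (n : ℕ) (η : Config L N) :
    ((ringOp A B a b L)^[n] f) η ≤ ((ringOp A B a b L)^[n] g) η := by
  rw [← integral_ringChainLaw, ← integral_ringChainLaw]
  refine integral_mono ?_ ?_ fun ω => h _
  · exact Integrable.comp_measurable (g := f) Integrable.of_finite (measurable_pi_apply n)
  · exact Integrable.comp_measurable (g := g) Integrable.of_finite (measurable_pi_apply n)

theorem ringOp_iterate_add (A B : ℝ≥0) (a b : ℝ) (L : ℕ+) {N : ℕ} (f g : Config L N → ℝ)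
    (n : ℕ) (η : Config L N) : ((ringOp A B a b L)^[n] fun ξ => f ξ + g ξ) η =
      ((ringOp A B a b L)^[n] f) η + ((ringOp A B a b L)^[n] g) η := by
  rw [← integral_ringChainLaw, ← integral_ringChainLaw, ← integral_ringChainLaw]
  refine integral_add ?_ ?_
  · exact Integrable.comp_measurable (g := f) Integrable.of_finite (measurable_pi_apply n)
  · exact Integrable.comp_measurable (g := g) Integrable.of_finite (measurable_pi_apply n)

theorem ringOp_iterate_const_mul (A B : ℝ≥0) (a b : ℝ) (L : ℕ+) {N : ℕ} (c : ℝ)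
    (f : Config L N → ℝ) (n : ℕ) (η : Config L N) :
    ((ringOp A B a b L)^[n] fun ξ => c * f ξ) η = c * ((ringOp A B a b L)^[n] f) η := by
  rw [← integral_ringChainLaw, ← integral_ringChainLaw, integral_const_mul]

theorem ringOp_iterate_zero (A B : ℝ≥0) (a b : ℝ) (L : ℕ+) {N : ℕ} (n : ℕ) (η : Config L N) :
    ((ringOp A B a b L)^[n] fun _ => 0) η = 0 := by
  rw [← integral_ringChainLaw, integral_zero]

theorem ringOp_iterate_le_self (A B : ℝ≥0) (a b : ℝ) (L : ℕ+) {N : ℕ} {f : Config L N → ℝ}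
    (h : ∀ η, labelGen A B a b L f η ≤ 0) (n : ℕ) (η : Config L N) :
    ((ringOp A B a b L)^[n] f) η ≤ f η := by
  induction n with
  | zero => exact le_rfl
  | succ n ih =>
    rw [Function.iterate_succ_apply]
    refine (ringOp_iterate_mono A B a b L (fun ξ => ?_) n η).trans ih
    rw [ringOp_eq]
    have : (0 : ℝ) ≤ (totalRate A B a b L : ℝ)⁻¹ := by positivity
    nlinarith [mul_nonneg this (neg_nonneg.2 (h ξ))]

theorem self_le_ringOp_iterate (A B : ℝ≥0) (a b : ℝ) (L : ℕ+) {N : ℕ} {f : Config L N → ℝ}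
    (h : ∀ η, 0 ≤ labelGen A B a b L f η) (n : ℕ) (η : Config L N) :
    f η ≤ ((ringOp A B a b L)^[n] f) η := by
  have h1 := ringOp_iterate_le_self A B a b L (f := fun ξ => -f ξ)
    (fun ξ => by rw [labelGen_neg]; linarith [h ξ]) n η
  have h2 := ringOp_iterate_const_mul A B a b L (-1) f n η
  simp only [neg_one_mul] at h2
  rw [h2] at h1
  linarith

/-- If `f ≥ 0` is dominated by `-𝓛T` with `T ≥ 0`, then the mean of `f` tends to `0`. -/
theorem tendsto_ringOp_iterate_zero (A B : ℝ≥0) (a b : ℝ) (L : ℕ+) {N : ℕ}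
    {f T : Config L N → ℝ} (hf : ∀ η, 0 ≤ f η) (hT : ∀ η, 0 ≤ T η)
    (h : ∀ η, labelGen A B a b L T η ≤ -f η) (η : Config L N) :
    Tendsto (fun n => ((ringOp A B a b L)^[n] f) η) atTop (nhds 0) := by
  have hΛ : (0 : ℝ) < totalRate A B a b L := by exact_mod_cast totalRate_pos A B a b L
  have hnn : ∀ n, 0 ≤ ((ringOp A B a b L)^[n] f) η := fun n => by
    rw [← ringOp_iterate_zero A B a b L n η]
    exact ringOp_iterate_mono A B a b L hf n η
  have hTn : ∀ n, 0 ≤ ((ringOp A B a b L)^[n] T) η := fun n => by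
    rw [← ringOp_iterate_zero A B a b L n η]
    exact ringOp_iterate_mono A B a b L hT n η
  have hstep : ∀ n, ((ringOp A B a b L)^[n] f) η ≤
      totalRate A B a b L * (((ringOp A B a b L)^[n] T) η - ((ringOp A B a b L)^[n + 1] T) η) := by
    intro n
    have h1 : ((ringOp A B a b L)^[n + 1] T) η ≤ ((ringOp A B a b L)^[n] fun ξ =>
        T ξ + (-(totalRate A B a b L : ℝ)⁻¹) * f ξ) η := by
      rw [Function.iterate_succ_apply]
      refine ringOp_iterate_mono A B a b L (fun ξ => ?_) n η
      rw [ringOp_eq, neg_mul, ← mul_neg]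
      gcongr
      exact h ξ
    rw [ringOp_iterate_add, ringOp_iterate_const_mul] at h1
    have h2 : ((ringOp A B a b L)^[n] f) η = totalRate A B a b L *
        ((totalRate A B a b L : ℝ)⁻¹ * ((ringOp A B a b L)^[n] f) η) := by
      rw [mul_inv_cancel_left₀ hΛ.ne']
    rw [h2]
    gcongr
    linarith
  have hsum : Summable fun n => ((ringOp A B a b L)^[n] f) η := by
    refine summable_of_sum_range_le (c := totalRate A B a b L * T η) hnn fun n => ?_
    calc ∑ i ∈ Finset.range n, ((ringOp A B a b L)^[i] f) η
        ≤ ∑ i ∈ Finset.range n, (totalRate A B a b L : ℝ) *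
          (((ringOp A B a b L)^[i] T) η - ((ringOp A B a b L)^[i + 1] T) η) :=
          Finset.sum_le_sum fun i _ => hstep i
      _ = totalRate A B a b L * (T η - ((ringOp A B a b L)^[n] T) η) := by
          rw [← Finset.mul_sum, Finset.sum_range_sub' fun i => ((ringOp A B a b L)^[i] T) η]
          rfl
      _ ≤ totalRate A B a b L * T η := by
          gcongr
          linarith [hTn n]
  exact hsum.tendsto_atTop_zero

open Finset in
theorem abs_prod_sub_prod_le {ι : Type*} [DecidableEq ι] (s : Finset ι) (g g' : ι → ℝ)
    (hg : ∀ i, |g i| ≤ 1) (hg' : ∀ i, |g' i| ≤ 1) :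
    |∏ i ∈ s, g' i - ∏ i ∈ s, g i| ≤ ∑ i ∈ s, |g' i - g i| := by
  induction s using Finset.induction_on with
  | empty => simp
  | insert x s hx ih =>
    rw [prod_insert hx, prod_insert hx, sum_insert hx]
    have e : g' x * ∏ i ∈ s, g' i - g x * ∏ i ∈ s, g i =
        (g' x - g x) * ∏ i ∈ s, g' i + g x * (∏ i ∈ s, g' i - ∏ i ∈ s, g i) := by ring
    rw [e]
    refine (abs_add_le _ _).trans ?_
    rw [abs_mul, abs_mul]
    have h1 : |∏ i ∈ s, g' i| ≤ 1 := by
      rw [abs_prod]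
      exact prod_le_one (fun i _ => abs_nonneg _) fun i _ => hg' i
    have h2 := hg x
    have h3 := abs_nonneg (g' x - g x)
    have h4 := abs_nonneg (∏ i ∈ s, g' i - ∏ i ∈ s, g i)
    nlinarith [mul_le_mul_of_nonneg_left h1 h3, mul_le_mul_of_nonneg_right h2 h4]

open Finset in
theorem abs_prod_sub_linear_le {ι : Type*} [DecidableEq ι] (s : Finset ι) (g g' : ι → ℝ)
    (hg : ∀ i, |g i| ≤ 1) (hg' : ∀ i, |g' i| ≤ 1) :
    |∏ i ∈ s, g' i - ∏ i ∈ s, g i - ∑ i ∈ s, (g' i - g i) * ∏ j ∈ s.erase i, g j| ≤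
      ∑ q ∈ s.offDiag, |g' q.1 - g q.1| * |g' q.2 - g q.2| := by
  induction s using Finset.induction_on with
  | empty => simp
  | insert x s hx ih =>
    have e1 : ∑ i ∈ insert x s, (g' i - g i) * ∏ j ∈ (insert x s).erase i, g j =
        (g' x - g x) * ∏ j ∈ s, g j + g x * ∑ i ∈ s, (g' i - g i) * ∏ j ∈ s.erase i, g j := by
      rw [sum_insert hx, erase_insert hx, mul_sum]
      congr 1
      refine sum_congr rfl fun i hi => ?_
      have hxi : x ≠ i := fun h => hx (h ▸ hi)
      rw [erase_insert_of_ne hxi, prod_insert (fun h => hx (mem_of_mem_erase h))]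
      ring
    have e2 : (∑ i ∈ s, |g' x - g x| * |g' i - g i|) +
        ∑ q ∈ s.offDiag, |g' q.1 - g q.1| * |g' q.2 - g q.2| ≤
        ∑ q ∈ (insert x s).offDiag, |g' q.1 - g q.1| * |g' q.2 - g q.2| := by
      have e3 : ∑ i ∈ s, |g' x - g x| * |g' i - g i| =
          ∑ q ∈ {x} ×ˢ s, |g' q.1 - g q.1| * |g' q.2 - g q.2| := by
        rw [sum_product, sum_singleton]
      rw [e3, ← sum_union]
      · refine sum_le_sum_of_subset_of_nonneg ?_ fun q _ _ => by positivity
        intro q hq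
        simp only [mem_union, mem_product, mem_singleton, mem_offDiag, mem_insert] at hq ⊢
        rcases hq with ⟨h1, h2⟩ | ⟨h1, h2, h3⟩
        · exact ⟨Or.inl h1, Or.inr h2, fun h => hx (h1 ▸ h ▸ h2)⟩
        · exact ⟨Or.inr h1, Or.inr h2, h3⟩
      · rw [disjoint_left]
        intro q hq hq'
        simp only [mem_product, mem_singleton, mem_offDiag] at hq hq'
        exact hx (hq.1 ▸ hq'.1)
    refine le_trans ?_ e2
    rw [prod_insert hx, prod_insert hx, e1]
    have e : g' x * ∏ i ∈ s, g' i - g x * ∏ i ∈ s, g i - ((g' x - g x) * ∏ j ∈ s, g j +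
        g x * ∑ i ∈ s, (g' i - g i) * ∏ j ∈ s.erase i, g j) =
        (g' x - g x) * (∏ i ∈ s, g' i - ∏ i ∈ s, g i) + g x * (∏ i ∈ s, g' i - ∏ i ∈ s, g i -
          ∑ i ∈ s, (g' i - g i) * ∏ j ∈ s.erase i, g j) := by ring
    rw [e]
    refine (abs_add_le _ _).trans ?_
    rw [abs_mul, abs_mul, ← mul_sum]
    refine add_le_add ?_ ?_
    · exact mul_le_mul_of_nonneg_left (abs_prod_sub_prod_le s g g' hg hg') (abs_nonneg _)
    · exact (mul_le_of_le_one_left (abs_nonneg _) (hg x)).trans ih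

/-- The rate of the simultaneous changes of `h` at the positions of two particles. -/
def pairSource (A B : ℝ≥0) (a b : ℝ) (L : ℕ+) (h : Site L → ℝ) (x y : Site L) : ℝ :=
  ∑ e, (clockRate A B a b L e : ℝ) *
    ∫ p in (0 : ℝ)..1, |siteOp e p h x - h x| * |siteOp e p h y - h y|

theorem abs_labelGen_prod_le (A B : ℝ≥0) (a b : ℝ) (L : ℕ+) {N : ℕ} (h : Site L → ℝ)
    (g : Fin N → Site L → ℝ) (hg1 : ∀ i x, |g i x| ≤ 1)
    (hgen : ∀ i x, siteGen A B a b L (g i) x = 0)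
    (hgh : ∀ i e p x, |siteOp e p (g i) x - g i x| = |siteOp e p h x - h x|) (η : Config L N) :
    |labelGen A B a b L (fun ξ => ∏ i, g i (ξ i)) η| ≤
      ∑ q ∈ Finset.univ.offDiag, pairSource A B a b L h (η q.1) (η q.2) := by
  classical
  have hop : ∀ e, ∀ p ∈ Set.Icc (0 : ℝ) 1, ∀ i x, |siteOp e p (g i) x| ≤ 1 := by
    intro e p hp i x
    have h1 := siteOp_mono e hp (fun u => (abs_le.1 (hg1 i u)).2) x
    have h2 := siteOp_mono e hp (fun u => (abs_le.1 (hg1 i u)).1) x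
    rw [siteOp_const] at h1 h2
    exact abs_le.2 ⟨h2, h1⟩
  have hcont := fun e i => continuous_siteOp e (g i) (η i)
  have hcont' := fun (e : Clock L) x => continuous_siteOp e h x
  have hlin : ∑ e, (clockRate A B a b L e : ℝ) * ∑ i, (oneOp e (g i) (η i) - g i (η i)) *
      ∏ j ∈ Finset.univ.erase i, g j (η j) = 0 := by
    simp only [Finset.mul_sum]
    rw [Finset.sum_comm]
    refine Finset.sum_eq_zero fun i _ => ?_
    simp only [← mul_assoc, ← Finset.sum_mul]
    rw [← siteGen, hgen, zero_mul]
  have hrw : labelGen A B a b L (fun ξ => ∏ i, g i (ξ i)) η =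
      ∑ e, (clockRate A B a b L e : ℝ) * ∫ p in (0 : ℝ)..1,
        (∏ i, siteOp e p (g i) (η i) - ∏ i, g i (η i) - ∑ i, (siteOp e p (g i) (η i) -
          g i (η i)) * ∏ j ∈ Finset.univ.erase i, g j (η j)) := by
    have hsub : labelGen A B a b L (fun ξ => ∏ i, g i (ξ i)) η =
        labelGen A B a b L (fun ξ => ∏ i, g i (ξ i)) η - ∑ e, (clockRate A B a b L e : ℝ) *
          ∑ i, (oneOp e (g i) (η i) - g i (η i)) * ∏ j ∈ Finset.univ.erase i, g j (η j) := by
      rw [hlin, sub_zero]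
    rw [hsub, labelGen, ← Finset.sum_sub_distrib]
    refine Finset.sum_congr rfl fun e _ => ?_
    rw [← mul_sub, clockOp_prod, intervalIntegral.integral_sub, intervalIntegral.integral_sub,
      intervalIntegral.integral_finsetSum]
    · simp only [intervalIntegral.integral_mul_const]
      congr 2
      · simp
      · refine Finset.sum_congr rfl fun i _ => ?_
        rw [intervalIntegral.integral_sub, oneOp]
        · simp
        · exact (hcont e i).intervalIntegrable _ _
        · simp
    · intro i _
      exact (((hcont e i).sub continuous_const).mul continuous_const).intervalIntegrable _ _
    · exact (continuous_finsetProd _ fun i _ => hcont e i).intervalIntegrable _ _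
    · simp
    · exact ((continuous_finsetProd _ fun i _ => hcont e i).sub
        continuous_const).intervalIntegrable _ _
    · exact (continuous_finsetSum _ fun i _ => ((hcont e i).sub continuous_const).mul
        continuous_const).intervalIntegrable _ _
  rw [hrw]
  refine (Finset.abs_sum_le_sum_abs _ _).trans ?_
  simp only [pairSource]
  rw [Finset.sum_comm]
  refine Finset.sum_le_sum fun e _ => ?_
  rw [abs_mul, abs_of_nonneg (NNReal.coe_nonneg _), ← Finset.mul_sum]
  refine mul_le_mul_of_nonneg_left ?_ (NNReal.coe_nonneg _)
  refine (intervalIntegral.abs_integral_le_integral_abs zero_le_one).trans ?_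
  rw [← intervalIntegral.integral_finsetSum]
  · refine intervalIntegral.integral_mono_on zero_le_one ?_ ?_ fun p hp => ?_
    · refine Continuous.intervalIntegrable (Continuous.abs ?_) _ _
      exact ((continuous_finsetProd _ fun i _ => hcont e i).sub continuous_const).sub
        (continuous_finsetSum _ fun i _ => ((hcont e i).sub continuous_const).mul
          continuous_const)
    · exact (continuous_finsetSum _ fun q _ => ((hcont' e _).sub continuous_const).abs.mul
        ((hcont' e _).sub continuous_const).abs).intervalIntegrable _ _
    · refine (abs_prod_sub_linear_le Finset.univ (fun i => g i (η i))
        (fun i => siteOp e p (g i) (η i)) (fun i => hg1 i _) fun i => hop e p hp i _).trans ?_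
      simp only [hgh, le_refl]
  · intro q _
    exact (((hcont' e _).sub continuous_const).abs.mul
        ((hcont' e _).sub continuous_const).abs).intervalIntegrable _ _

/-- The indicator function of the chain. -/
def alive {L : ℕ+} : Site L → ℝ
  | Sum.inl _ => 1
  | Sum.inr _ => 0

/-- The function `h` or `1 - h`. -/
def towards {L : ℕ+} (h : Site L → ℝ) : Reservoir → Site L → ℝ
  | Reservoir.plus, x => h x
  | Reservoir.minus, x => 1 - h x

theorem siteGen_towards (A B : ℝ≥0) (a b : ℝ) (L : ℕ+) {h : Site L → ℝ}
    (hh : ∀ x, siteGen A B a b L h x = 0) (s : Reservoir) (x : Site L) :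
    siteGen A B a b L (towards h s) x = 0 := by
  cases s with
  | plus => exact hh x
  | minus =>
    have h1 : ∀ e, oneOp e (fun u => 1 - h u) x = 1 - oneOp e h x := by
      intro e
      simp only [oneOp, siteOp_sub, siteOp_const]
      rw [intervalIntegral.integral_sub (by simp)
        ((continuous_siteOp e h x).intervalIntegrable _ _)]
      simp
    rw [← neg_eq_zero, ← hh x]
    simp only [siteGen, ← Finset.sum_neg_distrib]
    refine Finset.sum_congr rfl fun e _ => ?_
    change -(_ * (oneOp e (fun u => 1 - h u) x - (1 - h x))) = _
    rw [h1]
    ring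

theorem abs_hitProb_sub_prod_le (A B : ℝ≥0) (a b : ℝ) (L : ℕ+) {h t : Site L → ℝ}
    (hh : ∀ x, siteGen A B a b L h x = 0) (h0 : ∀ x, 0 ≤ h x) (h1 : ∀ x, h x ≤ 1)
    (hminus : h (Sum.inr Reservoir.minus) = 0) (hplus : h (Sum.inr Reservoir.plus) = 1)
    (ht0 : ∀ x, 0 ≤ t x) (ht : ∀ x, siteGen A B a b L t x ≤ -alive x)
    {R : Site L → Site L → ℝ} (hR0 : ∀ x y, 0 ≤ R x y)
    (hR : ∀ x y, pairGen A B a b L R x y ≤ -pairSource A B a b L h x y)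
    {N : ℕ} (x : Fin N → Chain L) (ε : Fin N → Reservoir) :
    |hitProb A B a b L x ε - ∏ i, towards h (ε i) (Sum.inl (x i))| ≤
      ∑ q ∈ Finset.univ.offDiag, R (Sum.inl (x q.1)) (Sum.inl (x q.2)) := by
  classical
  set η : Config L N := fun i => Sum.inl (x i)
  set G : Config L N → ℝ := fun ξ => ∏ i, towards h (ε i) (ξ i) with hG
  set W : Config L N → ℝ := fun ξ => ∑ q ∈ Finset.univ.offDiag, R (ξ q.1) (ξ q.2) with hW
  set T : Config L N → ℝ := fun ξ => ∑ i, t (ξ i) with hT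
  set S : Config L N → ℝ := fun ξ => ∑ i, alive (ξ i) with hS
  have htw0 : ∀ s x, 0 ≤ towards h s x := by
    intro s x
    cases s
    · simp [towards, h1]
    · simp [towards, h0]
  have htw1 : ∀ s x, towards h s x ≤ 1 := by
    intro s x
    cases s
    · simp [towards, h0]
    · simp [towards, h1]
  have halive0 : ∀ x : Site L, 0 ≤ alive x := by
    rintro (x | x) <;> simp [alive]
  have hS0 : ∀ ξ, 0 ≤ S ξ := fun ξ => Finset.sum_nonneg fun i _ => halive0 _
  have hlim : Tendsto (fun n => ((ringOp A B a b L)^[n] S) η) atTop (nhds 0) := by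
    refine tendsto_ringOp_iterate_zero A B a b L (T := T) hS0
      (fun ξ => Finset.sum_nonneg fun i _ => ht0 _) (fun ξ => ?_) η
    rw [hT, labelGen_finsetSum, hS, ← Finset.sum_neg_distrib]
    refine Finset.sum_le_sum fun i _ => ?_
    rw [labelGen_coord]
    exact ht _
  have hG0 : ∀ ξ, 0 ≤ G ξ := fun ξ => Finset.prod_nonneg fun i _ => htw0 _ _
  have hG1 : ∀ ξ, G ξ ≤ 1 := fun ξ => Finset.prod_le_one (fun i _ => htw0 _ _) fun i _ => htw1 _ _
  have hGabs : ∀ ξ, absorbedAt ε ξ ≤ G ξ ∧ G ξ ≤ absorbedAt ε ξ + S ξ := by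
    intro ξ
    by_cases hξ : ∃ i c, ξ i = Sum.inl c
    · obtain ⟨i, c, hi⟩ := hξ
      have e1 : absorbedAt ε ξ = 0 := by
        rw [absorbedAt, if_neg]
        intro h
        rw [h] at hi
        cases hi
      have e2 : 1 ≤ S ξ := by
        calc (1 : ℝ) = alive (ξ i) := by rw [hi]; rfl
          _ ≤ S ξ := Finset.single_le_sum (f := fun i => alive (ξ i)) (fun i _ => halive0 _)
            (Finset.mem_univ i)
      rw [e1]
      exact ⟨hG0 ξ, by linarith [hG1 ξ]⟩
    · have hξ' : ∀ i, ∃ s, ξ i = Sum.inr s := by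
        intro i
        rcases hi : ξ i with c | s
        · exact absurd ⟨i, c, hi⟩ hξ
        · exact ⟨s, rfl⟩
      choose s hs using hξ'
      have e3 : G ξ = absorbedAt ε ξ := by
        rw [absorbedAt]
        split_ifs with hif
        · rw [hG]
          refine Finset.prod_eq_one fun i _ => ?_
          rw [hif]
          change towards h (ε i) (Sum.inr (ε i)) = 1
          cases ε i <;> simp [towards, hminus, hplus]
        · obtain ⟨i, hi⟩ : ∃ i, ξ i ≠ Sum.inr (ε i) := by
            by_contra! hc
            exact hif (funext hc)
          refine Finset.prod_eq_zero (Finset.mem_univ i) ?_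
          rw [hs i] at hi ⊢
          have : s i ≠ ε i := fun h => hi (by rw [h])
          revert this
          cases s i <;> cases ε i <;> simp [towards, hminus, hplus]
      rw [e3]
      exact ⟨le_rfl, by linarith [hS0 ξ]⟩
  have hlimG : Tendsto (fun n => ((ringOp A B a b L)^[n] G) η) atTop
      (nhds (hitProb A B a b L x ε)) := by
    have hl := tendsto_ringOp_absorbedAt A B a b L x ε
    refine tendsto_of_tendsto_of_tendsto_of_le_of_le hl (by simpa using hl.add hlim)
      (fun n => ringOp_iterate_mono A B a b L (fun ξ => (hGabs ξ).1) n η) fun n => ?_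
    rw [← ringOp_iterate_add]
    exact ringOp_iterate_mono A B a b L (fun ξ => (hGabs ξ).2) n η
  have hW0 : ∀ ξ, 0 ≤ W ξ := fun ξ => Finset.sum_nonneg fun q _ => hR0 _ _
  have hgenG : ∀ ξ, |labelGen A B a b L G ξ| ≤ -labelGen A B a b L W ξ := by
    intro ξ
    refine (abs_labelGen_prod_le A B a b L h (fun i => towards h (ε i))
      (fun i x => abs_le.2 ⟨by linarith [htw0 (ε i) x], htw1 _ _⟩)
      (fun i x => siteGen_towards A B a b L hh _ _) (fun i e p x => ?_) ξ).trans ?_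
    · cases ε i with
      | plus => rfl
      | minus =>
        change |siteOp e p (fun u => 1 - h u) x - (1 - h x)| = _
        rw [siteOp_sub, siteOp_const, ← abs_neg]
        congr 1
        ring
    · rw [hW, labelGen_finsetSum, ← Finset.sum_neg_distrib]
      refine Finset.sum_le_sum fun q hq => ?_
      rw [labelGen_pair A B a b L R (Finset.mem_offDiag.1 hq).2.2]
      linarith [hR (ξ q.1) (ξ q.2)]
  have hupper : ∀ n, ((ringOp A B a b L)^[n] G) η ≤ G η + W η := by
    intro n
    refine (ringOp_iterate_mono A B a b L (g := fun ξ => G ξ + W ξ)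
      (fun ξ => by linarith [hW0 ξ]) n η).trans (ringOp_iterate_le_self A B a b L (fun ξ => ?_) n η)
    rw [labelGen_add]
    linarith [(abs_le.1 (hgenG ξ)).2]
  have hlower : ∀ n, G η - W η ≤ ((ringOp A B a b L)^[n] G) η := by
    intro n
    have := self_le_ringOp_iterate A B a b L (f := fun ξ => G ξ + -W ξ) (fun ξ => ?_) n η
    · refine (le_of_eq (sub_eq_add_neg _ _)).trans (this.trans ?_)
      exact ringOp_iterate_mono A B a b L (fun ξ => by linarith [hW0 ξ]) n η
    · rw [labelGen_add, labelGen_neg]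
      linarith [(abs_le.1 (hgenG ξ)).1]
  rw [abs_le]
  constructor
  · linarith [ge_of_tendsto' hlimG hlower]
  · linarith [le_of_tendsto' hlimG hupper]

theorem sum_reservoir (f : Reservoir → ℝ) : ∑ s, f s = f Reservoir.minus + f Reservoir.plus := by
  have : (Finset.univ : Finset Reservoir) = {Reservoir.minus, Reservoir.plus} := rfl
  rw [this, Finset.sum_pair (by decide)]

theorem sum_clock {L : ℕ+} (f : Clock L → ℝ) :
    ∑ e, f e = ∑ k, f (Sum.inl k) + (f (Sum.inr Reservoir.minus) + f (Sum.inr Reservoir.plus)) := by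
  rw [Fintype.sum_sum_type, sum_reservoir]

theorem clockRate_inr_pos {A B : ℝ≥0} (hA : 0 < A) (hB : 0 < B) (a b : ℝ) (L : ℕ+)
    (s : Reservoir) : (0 : ℝ) < clockRate A B a b L (Sum.inr s) := by
  have hL : (0 : ℝ≥0) < ((L : ℕ) : ℝ≥0) := by exact_mod_cast L.pos
  cases s
  · exact_mod_cast div_pos hA (NNReal.rpow_pos hL)
  · exact_mod_cast div_pos hB (NNReal.rpow_pos hL)

/-- The position of a site on the line, where the reservoirs are the neighbours of the ends of the
chain. -/
def rank {L : ℕ+} : Site L → ℤ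
  | Sum.inl x => x
  | Sum.inr Reservoir.minus => -L - 1
  | Sum.inr Reservoir.plus => L + 1

@[simp] theorem rank_bondLeft {L : ℕ+} (k : Set.Ico (-(L : ℤ)) (L : ℤ)) :
    rank (bondLeft k) = k := rfl

@[simp] theorem rank_bondRight {L : ℕ+} (k : Set.Ico (-(L : ℤ)) (L : ℤ)) :
    rank (bondRight k) = k + 1 := rfl

@[simp] theorem rank_boundary_minus (L : ℕ+) : rank (boundarySite L Reservoir.minus) = -L := rfl

@[simp] theorem rank_boundary_plus (L : ℕ+) : rank (boundarySite L Reservoir.plus) = L := rfl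

@[simp] theorem rank_minus (L : ℕ+) : rank (Sum.inr Reservoir.minus : Site L) = -L - 1 := rfl

@[simp] theorem rank_plus (L : ℕ+) : rank (Sum.inr Reservoir.plus : Site L) = L + 1 := rfl

@[simp] theorem rank_inl {L : ℕ+} (x : Chain L) : rank (Sum.inl x : Site L) = x := rfl

theorem rank_injective {L : ℕ+} : Function.Injective (rank (L := L)) := by
  rintro (x | s) (y | t) h
  · exact congrArg _ (Subtype.ext h)
  · have := x.2.1
    have := x.2.2
    cases t <;> simp at h <;> omega
  · have := y.2.1
    have := y.2.2
    cases s <;> simp at h <;> omega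
  · have := L.pos
    cases s <;> cases t <;> simp at h <;> first | rfl | omega

theorem rank_bounds {L : ℕ+} (x : Site L) : -(L : ℤ) - 1 ≤ rank x ∧ rank x ≤ L + 1 := by
  have := L.pos
  rcases x with x | s
  · have := x.2.1
    have := x.2.2
    simp only [rank_inl]
    omega
  · cases s <;> simp only [rank_minus, rank_plus] <;> omega

theorem eq_iff_rank {L : ℕ+} {x y : Site L} : x = y ↔ rank x = rank y :=
  rank_injective.eq_iff.symm

/-- A site belongs to the bond `{k, k+1}`. -/
def inBond {L : ℕ+} (k : Set.Ico (-(L : ℤ)) (L : ℤ)) (x : Site L) : Prop :=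
  x = bondLeft k ∨ x = bondRight k

instance {L : ℕ+} (k : Set.Ico (-(L : ℤ)) (L : ℤ)) (x : Site L) : Decidable (inBond k x) :=
  inferInstanceAs (Decidable (x = bondLeft k ∨ x = bondRight k))

theorem inBond_iff_rank {L : ℕ+} {k : Set.Ico (-(L : ℤ)) (L : ℤ)} {x : Site L} :
    inBond k x ↔ rank x = k ∨ rank x = k + 1 := by
  rw [inBond, eq_iff_rank, eq_iff_rank, rank_bondLeft, rank_bondRight]

theorem siteOp_bond_of_mem {L : ℕ+} {k : Set.Ico (-(L : ℤ)) (L : ℤ)} {x : Site L}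
    (h : inBond k x) (p : ℝ) (f : Site L → ℝ) :
    siteOp (Sum.inl k) p f x = p * f (bondLeft k) + (1 - p) * f (bondRight k) := if_pos h

theorem siteOp_bond_of_notMem {L : ℕ+} {k : Set.Ico (-(L : ℤ)) (L : ℤ)} {x : Site L}
    (h : ¬inBond k x) (p : ℝ) (f : Site L → ℝ) : siteOp (Sum.inl k) p f x = f x := if_neg h

theorem oneOp_bond_of_mem {L : ℕ+} {k : Set.Ico (-(L : ℤ)) (L : ℤ)} {x : Site L}
    (h : inBond k x) (f : Site L → ℝ) :
    oneOp (Sum.inl k) f x = (f (bondLeft k) + f (bondRight k)) / 2 := by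
  simp only [oneOp, siteOp_bond_of_mem h]
  rw [intervalIntegral.integral_add, intervalIntegral.integral_mul_const,
    intervalIntegral.integral_mul_const, intervalIntegral.integral_sub]
  · simp
    ring
  all_goals exact Continuous.intervalIntegrable (by fun_prop) _ _

theorem oneOp_bond_of_notMem {L : ℕ+} {k : Set.Ico (-(L : ℤ)) (L : ℤ)} {x : Site L}
    (h : ¬inBond k x) (f : Site L → ℝ) : oneOp (Sum.inl k) f x = f x := by
  simp [oneOp, siteOp_bond_of_notMem h]

theorem oneOp_sink {L : ℕ+} (s : Reservoir) (f : Site L → ℝ) (x : Site L) :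
    oneOp (Sum.inr s) f x = if x = boundarySite L s then f (Sum.inr s) else f x := by
  simp [oneOp, siteOp]

theorem siteOp_reservoir {L : ℕ+} (e : Clock L) (p : ℝ) (f : Site L → ℝ) (s : Reservoir) :
    siteOp e p f (Sum.inr s) = f (Sum.inr s) := by
  rcases e with k | r
  · simp [siteOp, bondLeft, bondRight]
  · cases r <;> simp [siteOp, boundarySite]

theorem siteGen_reservoir (A B : ℝ≥0) (a b : ℝ) (L : ℕ+) (f : Site L → ℝ) (s : Reservoir) :
    siteGen A B a b L f (Sum.inr s) = 0 := by
  simp [siteGen, oneOp, siteOp_reservoir]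

theorem siteGen_chain (A B : ℝ≥0) (a b : ℝ) (L : ℕ+) (f : Site L → ℝ) (F : ℤ → ℝ)
    (hF : ∀ y : Chain L, f (Sum.inl y) = F y) (x : Chain L) :
    siteGen A B a b L f (Sum.inl x) =
      (if (x : ℤ) < L then (F (x + 1) - F x) / 2 else 0) +
      (if -(L : ℤ) < x then (F (x - 1) - F x) / 2 else 0) +
      ((if (x : ℤ) = -L then (clockRate A B a b L (Sum.inr Reservoir.minus) : ℝ) *
        (f (Sum.inr Reservoir.minus) - F x) else 0) +
      (if (x : ℤ) = L then (clockRate A B a b L (Sum.inr Reservoir.plus) : ℝ) *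
        (f (Sum.inr Reservoir.plus) - F x) else 0)) := by
  have hb : ∀ k : Set.Ico (-(L : ℤ)) (L : ℤ), (clockRate A B a b L (Sum.inl k) : ℝ) *
      (oneOp (Sum.inl k) f (Sum.inl x) - f (Sum.inl x)) =
      (if (k : ℤ) = x then (F (x + 1) - F x) / 2 else 0) +
      (if (k : ℤ) = x - 1 then (F (x - 1) - F x) / 2 else 0) := by
    intro k
    have hl : f (bondLeft k) = F k := hF _
    have hr : f (bondRight k) = F (k + 1) := hF _
    have hm : inBond k (Sum.inl x : Site L) ↔ (x : ℤ) = k ∨ (x : ℤ) = k + 1 := inBond_iff_rank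
    by_cases h1 : (k : ℤ) = x
    · rw [oneOp_bond_of_mem (hm.2 (Or.inl h1.symm)), if_pos h1, if_neg (by omega), hl, hr, hF, h1,
        clockRate]
      push_cast
      ring
    · by_cases h2 : (k : ℤ) = x - 1
      · rw [oneOp_bond_of_mem (hm.2 (Or.inr (by omega))), if_neg h1, if_pos h2, hl, hr, hF, h2,
          clockRate, sub_add_cancel]
        push_cast
        ring
      · rw [oneOp_bond_of_notMem (by rw [hm]; omega), if_neg h1, if_neg h2]
        ring
  have hsum : ∀ g : ℤ → ℝ, ∑ k : Set.Ico (-(L : ℤ)) (L : ℤ), g k =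
      ∑ k ∈ Finset.Ico (-(L : ℤ)) (L : ℤ), g k := fun g =>
    (Finset.sum_subtype (Finset.Ico (-(L : ℤ)) (L : ℤ)) (fun k => by simp) g).symm
  have e1 : ∀ s : Reservoir, (Sum.inl x = boundarySite L s) ↔ (x : ℤ) = rank (boundarySite L s) :=
    fun s => eq_iff_rank
  rw [siteGen, sum_clock]
  simp only [hb]
  simp only [oneOp_sink, hF, e1, rank_boundary_minus, rank_boundary_plus]
  rw [hsum fun k => (if k = x then (F (x + 1) - F x) / 2 else 0) +
      (if k = x - 1 then (F (x - 1) - F x) / 2 else 0), Finset.sum_add_distrib,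
    Finset.sum_ite_eq', Finset.sum_ite_eq']
  have hx1 := x.2.1
  have hx2 := x.2.2
  congr 1
  · congr 1
    · simp only [Finset.mem_Ico, hx1, true_and]
    · have : ((x : ℤ) - 1 ∈ Finset.Ico (-(L : ℤ)) (L : ℤ)) ↔ -(L : ℤ) < x := by
        rw [Finset.mem_Ico]; omega
      simp only [this]
  · congr 1 <;> split_ifs <;> simp

/-- The slope of the harmonic function `harm`. -/
def harmSlope (A B : ℝ≥0) (a b : ℝ) (L : ℕ+) : ℝ :=
  (2 * (L : ℕ) + (2 * (clockRate A B a b L (Sum.inr Reservoir.minus) : ℝ))⁻¹ +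
    (2 * (clockRate A B a b L (Sum.inr Reservoir.plus) : ℝ))⁻¹)⁻¹

/-- The probability of absorption at `δ(+)` for one particle. -/
def harm (A B : ℝ≥0) (a b : ℝ) (L : ℕ+) : Site L → ℝ
  | Sum.inl x => harmSlope A B a b L *
      ((2 * (clockRate A B a b L (Sum.inr Reservoir.minus) : ℝ))⁻¹ + ((x : ℤ) + (L : ℕ)))
  | Sum.inr Reservoir.minus => 0
  | Sum.inr Reservoir.plus => 1

section

variable {A B : ℝ≥0} (a b : ℝ) (L : ℕ+)

theorem harmSlope_pos : 0 < harmSlope A B a b L := by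
  have : (0 : ℝ) < (L : ℕ) := by exact_mod_cast L.pos
  unfold harmSlope
  positivity

theorem harmSlope_mul_le : harmSlope A B a b L * (2 * (L : ℕ)) ≤ 1 := by
  have : (0 : ℝ) < (L : ℕ) := by exact_mod_cast L.pos
  unfold harmSlope
  rw [inv_mul_le_iff₀ (by positivity), mul_one, add_assoc]
  exact le_add_of_nonneg_right (by positivity)

theorem harmSlope_le_half : harmSlope A B a b L ≤ 1 / 2 := by
  have h1 : (1 : ℝ) ≤ (L : ℕ) := by exact_mod_cast L.pos
  have h2 := harmSlope_mul_le (A := A) (B := B) a b L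
  have h3 := harmSlope_pos (A := A) (B := B) a b L
  nlinarith

theorem harmSlope_mul_eq : harmSlope A B a b L *
    (2 * (L : ℕ) + (2 * (clockRate A B a b L (Sum.inr Reservoir.minus) : ℝ))⁻¹ +
    (2 * (clockRate A B a b L (Sum.inr Reservoir.plus) : ℝ))⁻¹) = 1 := by
  have : (0 : ℝ) < (L : ℕ) := by exact_mod_cast L.pos
  unfold harmSlope
  exact inv_mul_cancel₀ (by positivity)

theorem harm_bondRight (k : Set.Ico (-(L : ℤ)) (L : ℤ)) :
    harm A B a b L (bondRight k) = harm A B a b L (bondLeft k) + harmSlope A B a b L := by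
  simp only [harm, bondRight, bondLeft]
  push_cast
  ring

theorem one_sub_harm_plus : 1 - harm A B a b L (boundarySite L Reservoir.plus) =
    harmSlope A B a b L * (2 * (clockRate A B a b L (Sum.inr Reservoir.plus) : ℝ))⁻¹ := by
  nth_rewrite 1 [← harmSlope_mul_eq (A := A) (B := B) a b L]
  simp only [harm, boundarySite]
  push_cast
  ring

theorem harm_minus : harm A B a b L (boundarySite L Reservoir.minus) =
    harmSlope A B a b L * (2 * (clockRate A B a b L (Sum.inr Reservoir.minus) : ℝ))⁻¹ := by
  simp only [harm, boundarySite]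
  push_cast
  ring

theorem harm_chain_mono {x y : Chain L} (h : x ≤ y) :
    harm A B a b L (Sum.inl x) ≤ harm A B a b L (Sum.inl y) := by
  have hs := harmSlope_pos (A := A) (B := B) a b L
  have h' : ((x : ℤ) : ℝ) ≤ ((y : ℤ) : ℝ) := by exact_mod_cast h
  simp only [harm]
  gcongr

theorem harm_nonneg (x : Site L) : 0 ≤ harm A B a b L x := by
  rcases x with x | s
  · have hs := harmSlope_pos (A := A) (B := B) a b L
    have hx : (-((L : ℕ) : ℝ)) ≤ ((x : ℤ) : ℝ) := by exact_mod_cast x.2.1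
    simp only [harm]
    refine mul_nonneg hs.le (add_nonneg (by positivity) (by linarith))
  · cases s <;> simp [harm]

theorem harm_le_one (x : Site L) : harm A B a b L x ≤ 1 := by
  rcases x with x | s
  · have h1 : harm A B a b L (Sum.inl x) ≤ harm A B a b L (boundarySite L Reservoir.plus) :=
      harm_chain_mono a b L (x.2.2 : x ≤ ⟨(L : ℤ), by simp, le_rfl⟩)
    have h2 := one_sub_harm_plus (A := A) (B := B) a b L
    have h3 : 0 ≤ harmSlope A B a b L *
      (2 * (clockRate A B a b L (Sum.inr Reservoir.plus) : ℝ))⁻¹ :=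
      mul_nonneg (harmSlope_pos a b L).le (by positivity)
    linarith
  · cases s <;> simp [harm]

theorem harm_mono {x y : Site L} (h : rank x ≤ rank y) : harm A B a b L x ≤ harm A B a b L y := by
  have hL := L.pos
  rcases x with x | s
  · rcases y with y | t
    · exact harm_chain_mono a b L h
    · cases t
      · have := x.2.1
        simp only [rank_inl, rank_minus] at h
        omega
      · exact harm_le_one a b L _
  · cases s
    · exact harm_nonneg a b L _
    · have : y = Sum.inr Reservoir.plus := by
        rw [eq_iff_rank]
        exact le_antisymm (rank_bounds y).2 h
      rw [this]

theorem siteGen_harm (hA : 0 < A) (hB : 0 < B) (x : Site L) :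
    siteGen A B a b L (harm A B a b L) x = 0 := by
  rcases x with x | s
  · have hL : (1 : ℤ) ≤ L := by exact_mod_cast L.pos
    have hx1 := x.2.1
    have hx2 := x.2.2
    have hrm := clockRate_inr_pos hA hB a b L Reservoir.minus
    have hrp := clockRate_inr_pos hA hB a b L Reservoir.plus
    rw [siteGen_chain A B a b L _ (fun y : ℤ => harmSlope A B a b L *
      ((2 * (clockRate A B a b L (Sum.inr Reservoir.minus) : ℝ))⁻¹ + ((y : ℝ) + (L : ℕ))))
      (fun y => rfl)]
    by_cases h1 : (x : ℤ) = -L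
    · rw [if_pos (by omega), if_neg (by omega), if_pos h1, if_neg (by omega), h1]
      simp only [harm]
      push_cast
      field_simp
      ring
    · by_cases h2 : (x : ℤ) = L
      · have h3 := one_sub_harm_plus (A := A) (B := B) a b L
        have h4 : harm A B a b L (boundarySite L Reservoir.plus) = harmSlope A B a b L *
          ((2 * (clockRate A B a b L (Sum.inr Reservoir.minus) : ℝ))⁻¹ +
            (((L : ℤ) : ℝ) + (L : ℕ))) := rfl
        rw [if_neg (by omega), if_pos (by omega), if_neg h1, if_pos h2, h2, ← h4]
        have h5 : harm A B a b L (Sum.inr Reservoir.plus) = 1 := rfl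
        rw [h5, h3, h4]
        push_cast
        field_simp
        ring
      · rw [if_pos (by omega), if_pos (by omega), if_neg h1, if_neg h2]
        push_cast
        ring
  · exact siteGen_reservoir _ _ _ _ _ _ _

theorem exists_siteGen_le_neg_alive (hA : 0 < A) (hB : 0 < B) :
    ∃ t : Site L → ℝ, (∀ x, 0 ≤ t x) ∧ ∀ x, siteGen A B a b L t x ≤ -alive x := by
  have hrm := clockRate_inr_pos hA hB a b L Reservoir.minus
  have hrp := clockRate_inr_pos hA hB a b L Reservoir.plus
  set rm : ℝ := (clockRate A B a b L (Sum.inr Reservoir.minus) : ℝ)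
  set rp : ℝ := (clockRate A B a b L (Sum.inr Reservoir.plus) : ℝ)
  have hL : (1 : ℤ) ≤ L := by exact_mod_cast L.pos
  have hL' : (1 : ℝ) ≤ (L : ℕ) := by exact_mod_cast L.pos
  set D : ℝ := ((L : ℕ) + 1) * (rm⁻¹ + rp⁻¹) with hD
  have hD0 : 0 < D := by positivity
  have hDm : (L : ℕ) + 1 ≤ rm * D := by
    rw [hD]
    have e : rm * (((L : ℕ) + 1) * (rm⁻¹ + rp⁻¹)) = (L : ℕ) + 1 + ((L : ℕ) + 1) * (rm * rp⁻¹) := by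
      field_simp
    rw [e]
    exact le_add_of_nonneg_right (by positivity)
  have hDp : (L : ℕ) + 1 ≤ rp * D := by
    rw [hD]
    have e : rp * (((L : ℕ) + 1) * (rm⁻¹ + rp⁻¹)) = (L : ℕ) + 1 + ((L : ℕ) + 1) * (rp * rm⁻¹) := by
      field_simp
      ring
    rw [e]
    exact le_add_of_nonneg_right (by positivity)
  let t : Site L → ℝ := fun x => match x with
    | Sum.inl y => ((L : ℕ) : ℝ) ^ 2 + D - ((y : ℤ) : ℝ) ^ 2
    | Sum.inr _ => 0
  refine ⟨t, ?_, ?_⟩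
  · rintro (y | s)
    · have h1 : (-((L : ℕ) : ℝ)) ≤ ((y : ℤ) : ℝ) := by exact_mod_cast y.2.1
      have h2 : ((y : ℤ) : ℝ) ≤ ((L : ℕ) : ℝ) := by exact_mod_cast y.2.2
      change 0 ≤ ((L : ℕ) : ℝ) ^ 2 + D - ((y : ℤ) : ℝ) ^ 2
      nlinarith
    · exact le_rfl
  · rintro (x | s)
    · have hx1 := x.2.1
      have hx2 := x.2.2
      rw [siteGen_chain A B a b L t (fun y : ℤ => ((L : ℕ) : ℝ) ^ 2 + D - (y : ℝ) ^ 2)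
        (fun y => rfl)]
      simp only [alive]
      by_cases h1 : (x : ℤ) = -L
      · rw [if_pos (by omega), if_neg (by omega), if_pos h1, if_neg (by omega), h1]
        push_cast
        change _ + 0 + (rm * _ + 0) ≤ _
        linarith
      · by_cases h2 : (x : ℤ) = L
        · rw [if_neg (by omega), if_pos (by omega), if_neg h1, if_pos h2, h2]
          push_cast
          change 0 + _ + (0 + rp * _) ≤ _
          linarith
        · rw [if_pos (by omega), if_pos (by omega), if_neg h1, if_neg h2]
          push_cast
          linarith
    · rw [siteGen_reservoir]
      simp [alive]

end

theorem integral_quadratic (c₀ c₁ c₂ : ℝ) :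
    ∫ p in (0 : ℝ)..1, (c₀ + c₁ * p + c₂ * p ^ 2) = c₀ + c₁ / 2 + c₂ / 3 := by
  rw [intervalIntegral.integral_add, intervalIntegral.integral_add,
    intervalIntegral.integral_const_mul, intervalIntegral.integral_const_mul]
  · simp [integral_pow]
    ring
  all_goals exact Continuous.intervalIntegrable (by fun_prop) _ _

/-- The carré du champ of the harmonic function for two particles. -/
def pairCov (A B : ℝ≥0) (a b : ℝ) (L : ℕ+) (x y : Site L) : ℝ :=
  ∑ e, (clockRate A B a b L e : ℝ) * ∫ p in (0 : ℝ)..1,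
    (siteOp e p (harm A B a b L) x - harm A B a b L x) *
      (siteOp e p (harm A B a b L) y - harm A B a b L y)

/-- The number of bonds that contain two given sites. -/
def bondCount {L : ℕ+} (x y : Site L) : ℝ :=
  ∑ k, if inBond k x ∧ inBond k y then 1 else 0

/-- The rate of the simultaneous absorptions, weighted by the square of the change of `harm`. -/
def sinkTerm (A B : ℝ≥0) (a b : ℝ) (L : ℕ+) (x y : Site L) : ℝ :=
  ∑ s, (clockRate A B a b L (Sum.inr s) : ℝ) *
    if x = boundarySite L s ∧ y = boundarySite L s then
      (harm A B a b L (Sum.inr s) - harm A B a b L (boundarySite L s)) ^ 2 else 0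

section

variable {A B : ℝ≥0} (a b : ℝ) (L : ℕ+)

local notation "β" => harmSlope A B a b L
local notation "H" => harm A B a b L

theorem bondCount_nonneg (x y : Site L) : 0 ≤ bondCount x y :=
  Finset.sum_nonneg fun k _ => by split_ifs <;> norm_num

theorem sinkTerm_nonneg (x y : Site L) : 0 ≤ sinkTerm A B a b L x y :=
  Finset.sum_nonneg fun s _ => mul_nonneg (NNReal.coe_nonneg _) (by split_ifs <;> positivity)

theorem pairGen_harm_mul (hA : 0 < A) (hB : 0 < B) (x y : Site L) :
    pairGen A B a b L (fun u v => H u * H v) x y = pairCov A B a b L x y := by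
  have hx := siteGen_harm a b L hA hB x
  have hy := siteGen_harm a b L hA hB y
  have e1 : pairGen A B a b L (fun u v => H u * H v) x y =
      pairCov A B a b L x y + H x * siteGen A B a b L H y + H y * siteGen A B a b L H x := by
    simp only [pairGen, pairCov, siteGen, Finset.mul_sum, ← Finset.sum_add_distrib]
    refine Finset.sum_congr rfl fun e _ => ?_
    have cx := continuous_siteOp e H x
    have cy := continuous_siteOp e H y
    have e2 : pairOp e (fun u v => H u * H v) x y = (∫ p in (0 : ℝ)..1,
        (siteOp e p H x - H x) * (siteOp e p H y - H y)) + H x * oneOp e H y +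
          H y * oneOp e H x - H x * H y := by
      simp only [pairOp, pairSiteOp_mul, oneOp]
      rw [← intervalIntegral.integral_const_mul, ← intervalIntegral.integral_const_mul,
        ← intervalIntegral.integral_add, ← intervalIntegral.integral_add]
      · have e3 : H x * H y = ∫ _ in (0 : ℝ)..1, H x * H y := by simp
        rw [e3, ← intervalIntegral.integral_sub]
        · congr 1
          funext p
          ring
        all_goals exact Continuous.intervalIntegrable (by fun_prop) _ _
      all_goals exact Continuous.intervalIntegrable (by fun_prop) _ _
    rw [e2]
    ring
  rw [e1, hx, hy]
  ring

theorem siteOp_bond_harm_sub {k : Set.Ico (-(L : ℤ)) (L : ℤ)} {x : Site L} (p : ℝ)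
    (h : inBond k x) : siteOp (Sum.inl k) p H x - H x =
      (if x = bondLeft k then 1 - p else -p) * β := by
  rw [siteOp_bond_of_mem h, harm_bondRight]
  rcases h with h | h
  · rw [if_pos h, h]
    ring
  · have : x ≠ bondLeft k := by
      rw [h, Ne, eq_iff_rank, rank_bondLeft, rank_bondRight]
      omega
    rw [if_neg this, h, harm_bondRight]
    ring

theorem bond_cov_bounds (k : Set.Ico (-(L : ℤ)) (L : ℤ)) (x y : Site L) :
    -(β ^ 2 / 6) * (if inBond k x ∧ inBond k y then 1 else 0) ≤
      (∫ p in (0 : ℝ)..1, (siteOp (Sum.inl k) p H x - H x) * (siteOp (Sum.inl k) p H y - H y)) ∧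
    (∫ p in (0 : ℝ)..1, (siteOp (Sum.inl k) p H x - H x) * (siteOp (Sum.inl k) p H y - H y)) ≤
      β ^ 2 / 3 * (if inBond k x ∧ inBond k y then 1 else 0) := by
  by_cases hx : inBond k x
  · by_cases hy : inBond k y
    · simp only [siteOp_bond_harm_sub a b L _ hx, siteOp_bond_harm_sub a b L _ hy, hx, hy,
        and_self, if_true]
      have hb := sq_nonneg β
      split_ifs
      · have e : ∀ p : ℝ, (1 - p) * β * ((1 - p) * β) =
          β ^ 2 + (-2 * β ^ 2) * p + β ^ 2 * p ^ 2 := fun p => by ring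
        simp only [e, integral_quadratic]
        constructor <;> linarith
      · have e : ∀ p : ℝ, (1 - p) * β * (-p * β) =
          0 + (-β ^ 2) * p + β ^ 2 * p ^ 2 := fun p => by ring
        simp only [e, integral_quadratic]
        constructor <;> linarith
      · have e : ∀ p : ℝ, -p * β * ((1 - p) * β) =
          0 + (-β ^ 2) * p + β ^ 2 * p ^ 2 := fun p => by ring
        simp only [e, integral_quadratic]
        constructor <;> linarith
      · have e : ∀ p : ℝ, -p * β * (-p * β) =
          0 + 0 * p + β ^ 2 * p ^ 2 := fun p => by ring
        simp only [e, integral_quadratic]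
        constructor <;> linarith
    · simp [siteOp_bond_of_notMem hy, hy]
  · simp [siteOp_bond_of_notMem hx, hx]

theorem bond_abs_le (k : Set.Ico (-(L : ℤ)) (L : ℤ)) (x y : Site L) :
    (∫ p in (0 : ℝ)..1, |siteOp (Sum.inl k) p H x - H x| * |siteOp (Sum.inl k) p H y - H y|) ≤
      β ^ 2 * (if inBond k x ∧ inBond k y then 1 else 0) := by
  have hb := (harmSlope_pos (A := A) (B := B) a b L).le
  have hd : ∀ p ∈ Set.Icc (0 : ℝ) 1, ∀ z, inBond k z → |siteOp (Sum.inl k) p H z - H z| ≤ β := by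
    intro p hp z hz
    rw [siteOp_bond_harm_sub a b L _ hz, abs_mul, abs_of_nonneg hb]
    refine mul_le_of_le_one_left hb ?_
    split_ifs
    · rw [abs_le]; constructor <;> linarith [hp.1, hp.2]
    · rw [abs_le]; constructor <;> linarith [hp.1, hp.2]
  by_cases hx : inBond k x
  · by_cases hy : inBond k y
    · have h1 : (∫ p in (0 : ℝ)..1,
          |siteOp (Sum.inl k) p H x - H x| * |siteOp (Sum.inl k) p H y - H y|) ≤
          ∫ _ in (0 : ℝ)..1, β ^ 2 := by
        have cx := continuous_siteOp (Sum.inl k) H x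
        have cy := continuous_siteOp (Sum.inl k) H y
        refine intervalIntegral.integral_mono_on zero_le_one
          (Continuous.intervalIntegrable (by fun_prop) _ _) (by simp) fun p hp => ?_
        rw [sq]
        exact mul_le_mul (hd p hp x hx) (hd p hp y hy) (abs_nonneg _) hb
      simpa [hx, hy] using h1
    · simp [siteOp_bond_of_notMem hy, hy]
  · simp [siteOp_bond_of_notMem hx, hx]

theorem siteOp_sink_sub (s : Reservoir) (p : ℝ) (f : Site L → ℝ) (x : Site L) :
    siteOp (Sum.inr s) p f x - f x =
      if x = boundarySite L s then f (Sum.inr s) - f (boundarySite L s) else 0 := by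
  simp only [siteOp]
  split_ifs with h
  · rw [h]
  · ring

theorem sink_cov (s : Reservoir) (x y : Site L) :
    (∫ p in (0 : ℝ)..1, (siteOp (Sum.inr s) p H x - H x) * (siteOp (Sum.inr s) p H y - H y)) =
      if x = boundarySite L s ∧ y = boundarySite L s then
        (H (Sum.inr s) - H (boundarySite L s)) ^ 2 else 0 := by
  simp only [siteOp_sink_sub]
  split_ifs <;> simp_all [sq]

theorem sink_abs (s : Reservoir) (x y : Site L) :
    (∫ p in (0 : ℝ)..1, |siteOp (Sum.inr s) p H x - H x| * |siteOp (Sum.inr s) p H y - H y|) =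
      if x = boundarySite L s ∧ y = boundarySite L s then
        (H (Sum.inr s) - H (boundarySite L s)) ^ 2 else 0 := by
  simp only [siteOp_sink_sub]
  split_ifs <;> simp_all [sq]

theorem pairCov_bounds (x y : Site L) :
    -(β ^ 2 / 6) * bondCount x y + sinkTerm A B a b L x y ≤ pairCov A B a b L x y ∧
      pairCov A B a b L x y ≤ β ^ 2 / 3 * bondCount x y + sinkTerm A B a b L x y := by
  simp only [pairCov, Fintype.sum_sum_type, sink_cov, sinkTerm, bondCount, Finset.mul_sum]
  have hr : ∀ k, (clockRate A B a b L (Sum.inl k) : ℝ) = 1 := fun k => rfl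
  simp only [hr, one_mul]
  exact ⟨add_le_add_left (Finset.sum_le_sum fun k _ => (bond_cov_bounds a b L k x y).1) _,
    add_le_add_left (Finset.sum_le_sum fun k _ => (bond_cov_bounds a b L k x y).2) _⟩

theorem pairSource_le (x y : Site L) :
    pairSource A B a b L H x y ≤ β ^ 2 * bondCount x y + sinkTerm A B a b L x y := by
  simp only [pairSource, Fintype.sum_sum_type, sink_abs, sinkTerm, bondCount, Finset.mul_sum]
  have hr : ∀ k, (clockRate A B a b L (Sum.inl k) : ℝ) = 1 := fun k => rfl
  simp only [hr, one_mul]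
  exact add_le_add_left (Finset.sum_le_sum fun k _ => bond_abs_le a b L k x y) _

theorem siteOp_rank_mono (e : Clock L) {p : ℝ} (hp : p ∈ Set.Icc (0 : ℝ) 1) {f : Site L → ℝ}
    (hf : ∀ x y, rank x ≤ rank y → f x ≤ f y) {x y : Site L} (h : rank x ≤ rank y) :
    siteOp e p f x ≤ siteOp e p f y := by
  have hp0 := hp.1
  have hp1 := sub_nonneg.2 hp.2
  rcases e with k | s
  · by_cases hx : inBond k x
    · by_cases hy : inBond k y
      · rw [siteOp_bond_of_mem hx, siteOp_bond_of_mem hy]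
      · rw [siteOp_bond_of_mem hx, siteOp_bond_of_notMem hy]
        rw [inBond_iff_rank] at hx hy
        have h1 : f (bondLeft k) ≤ f y := hf _ _ (by rw [rank_bondLeft]; omega)
        have h2 : f (bondRight k) ≤ f y := hf _ _ (by rw [rank_bondRight]; omega)
        nlinarith
    · by_cases hy : inBond k y
      · rw [siteOp_bond_of_notMem hx, siteOp_bond_of_mem hy]
        rw [inBond_iff_rank] at hx hy
        have h1 : f x ≤ f (bondLeft k) := hf _ _ (by rw [rank_bondLeft]; omega)
        have h2 : f x ≤ f (bondRight k) := hf _ _ (by rw [rank_bondRight]; omega)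
        nlinarith
      · rw [siteOp_bond_of_notMem hx, siteOp_bond_of_notMem hy]
        exact hf _ _ h
  · have hbx := rank_bounds x
    have hby := rank_bounds y
    simp only [siteOp]
    cases s <;> split_ifs with h1 h2 h2 <;> rw [eq_iff_rank] at h1 h2 <;>
      simp only [rank_boundary_minus, rank_boundary_plus] at h1 h2 <;> apply hf <;>
      (try simp only [rank_minus, rank_plus]) <;> omega

/-- The minimum of the harmonic function at two sites. -/
def harmMin (A B : ℝ≥0) (a b : ℝ) (L : ℕ+) (x y : Site L) : ℝ :=
  min (harm A B a b L x) (harm A B a b L y)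

theorem pairSiteOp_swap (e : Clock L) (p : ℝ) (φ : Site L → Site L → ℝ) (x y : Site L) :
    pairSiteOp e p (fun u v => φ v u) y x = pairSiteOp e p φ x y := by
  simp only [pairSiteOp_eq_sum]
  have h1 : ∀ s, siteOp e p (fun v => φ v s) x = ∑ t, siteOp e p (Pi.single t 1) x * φ t s :=
    fun s => siteOp_eq_sum _ _ _ _
  have h2 : ∀ s, siteOp e p (φ s) y = ∑ t, siteOp e p (Pi.single t 1) y * φ s t :=
    fun s => siteOp_eq_sum _ _ _ _
  simp only [h1, h2, Finset.mul_sum]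
  rw [Finset.sum_comm]
  exact Finset.sum_congr rfl fun s _ => Finset.sum_congr rfl fun t _ => by ring

theorem pairOp_harmMin_of_le (e : Clock L) {x y : Site L} (h : rank x ≤ rank y) :
    pairOp e (harmMin A B a b L) x y = oneOp e H x -
      β / 6 * (match e with
        | Sum.inl k => if inBond k x ∧ inBond k y then 1 else 0
        | Sum.inr _ => 0) := by
  have hb := (harmSlope_pos (A := A) (B := B) a b L).le
  have hm : ∀ {u v : Site L}, rank u ≤ rank v → harmMin A B a b L u v = H u := fun h =>
    min_eq_left (harm_mono a b L h)
  rcases e with k | s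
  · have hlr := harm_bondRight (A := A) (B := B) a b L k
    by_cases hx : inBond k x
    · by_cases hy : inBond k y
      · have e1 : ∀ p, pairSiteOp (Sum.inl k) p (harmMin A B a b L) x y =
            (H (bondLeft k) + β) + (-2 * β) * p + β * p ^ 2 := by
          intro p
          rw [pairSiteOp, siteOp_bond_of_mem hx, siteOp_bond_of_mem hy, siteOp_bond_of_mem hy]
          simp only [harmMin, hlr, min_self, min_eq_left (le_add_of_nonneg_right hb),
            min_eq_right (le_add_of_nonneg_right hb)]
          ring
        simp only [pairOp, e1, integral_quadratic, oneOp_bond_of_mem hx, hlr, hx, hy, and_self,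
          if_true]
        ring
      · have e1 : ∀ p, pairSiteOp (Sum.inl k) p (harmMin A B a b L) x y =
            siteOp (Sum.inl k) p H x := by
          intro p
          rw [pairSiteOp, siteOp_bond_of_mem hx, siteOp_bond_of_mem hx, siteOp_bond_of_notMem hy,
            siteOp_bond_of_notMem hy]
          rw [inBond_iff_rank] at hx hy
          rw [hm (by rw [rank_bondLeft]; omega), hm (by rw [rank_bondRight]; omega)]
        simp only [pairOp, e1, oneOp, hy, and_false, if_false]
        ring
    · have e1 : ∀ p, pairSiteOp (Sum.inl k) p (harmMin A B a b L) x y =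
          siteOp (Sum.inl k) p H x := by
        intro p
        rw [pairSiteOp, siteOp_bond_of_notMem hx, siteOp_bond_of_notMem hx]
        by_cases hy : inBond k y
        · rw [siteOp_bond_of_mem hy]
          rw [inBond_iff_rank] at hx hy
          rw [hm (by rw [rank_bondLeft]; omega), hm (by rw [rank_bondRight]; omega)]
          ring
        · rw [siteOp_bond_of_notMem hy, hm h]
      simp only [pairOp, e1, oneOp, hx, false_and, if_false]
      ring
  · have e1 : ∀ p, pairSiteOp (Sum.inr s) p (harmMin A B a b L) x y =
        siteOp (Sum.inr s) p H x := by
      intro p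
      have hbx := rank_bounds x
      have hby := rank_bounds y
      simp only [pairSiteOp, siteOp]
      cases s <;> split_ifs with h1 h2 h2 <;> rw [eq_iff_rank] at h1 h2 <;>
        simp only [rank_boundary_minus, rank_boundary_plus] at h1 h2 <;> apply hm <;>
        (try simp only [rank_minus, rank_plus]) <;> omega
    simp only [pairOp, e1, oneOp]
    ring

theorem pairGen_harmMin (hA : 0 < A) (hB : 0 < B) (x y : Site L) :
    pairGen A B a b L (harmMin A B a b L) x y = -(β / 6) * bondCount x y := by
  have key : ∀ x y : Site L, rank x ≤ rank y →
      pairGen A B a b L (harmMin A B a b L) x y = -(β / 6) * bondCount x y := by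
    intro x y h
    have h1 : harmMin A B a b L x y = H x := min_eq_left (harm_mono a b L h)
    have h2 := siteGen_harm a b L hA hB x
    rw [siteGen, Fintype.sum_sum_type] at h2
    have hr : ∀ k, (clockRate A B a b L (Sum.inl k) : ℝ) = 1 := fun k => rfl
    simp only [pairGen, Fintype.sum_sum_type, pairOp_harmMin_of_le a b L _ h, h1, bondCount,
      Finset.mul_sum]
    refine Eq.trans ?_ ((congrArg (fun r => r + ∑ k, -(β / 6) *
      if inBond k x ∧ inBond k y then (1 : ℝ) else 0) h2).trans (zero_add _))
    rw [add_right_comm, ← Finset.sum_add_distrib]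
    congr 1
    · refine Finset.sum_congr rfl fun k _ => ?_
      rw [hr]
      ring
    · refine Finset.sum_congr rfl fun s _ => ?_
      ring
  rcases le_total (rank x) (rank y) with h | h
  · exact key x y h
  · rw [show bondCount x y = bondCount y x by simp only [bondCount, and_comm], ← key y x h]
    simp only [pairGen]
    have e1 : harmMin A B a b L x y = harmMin A B a b L y x := min_comm _ _
    have e2 : ∀ e, pairOp e (harmMin A B a b L) x y = pairOp e (harmMin A B a b L) y x := by
      intro e
      simp only [pairOp]
      congr 1
      funext p
      rw [← pairSiteOp_swap]
      congr 1
      funext u v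
      exact min_comm _ _
    simp only [e1, e2]

/-- The covariance of the events that the sites `x` and `y` lie below a uniform level. -/
def bridge (A B : ℝ≥0) (a b : ℝ) (L : ℕ+) (x y : Site L) : ℝ :=
  harmMin A B a b L x y - harm A B a b L x * harm A B a b L y

theorem bridge_nonneg (x y : Site L) : 0 ≤ bridge A B a b L x y := by
  have hx0 := harm_nonneg (A := A) (B := B) a b L x
  have hx1 := harm_le_one (A := A) (B := B) a b L x
  have hy0 := harm_nonneg (A := A) (B := B) a b L y
  have hy1 := harm_le_one (A := A) (B := B) a b L y
  rw [bridge, sub_nonneg, harmMin, le_min_iff]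
  constructor <;> nlinarith

theorem bridge_le_one (x y : Site L) : bridge A B a b L x y ≤ 1 := by
  have h1 : harmMin A B a b L x y ≤ H x := min_le_left _ _
  have h2 := harm_le_one (A := A) (B := B) a b L x
  have h3 := mul_nonneg (harm_nonneg (A := A) (B := B) a b L x)
    (harm_nonneg (A := A) (B := B) a b L y)
  rw [bridge]
  linarith

theorem bridge_reservoir_left (s : Reservoir) (y : Site L) :
    bridge A B a b L (Sum.inr s) y = 0 := by
  have h1 := harm_nonneg (A := A) (B := B) a b L y
  have h2 := harm_le_one (A := A) (B := B) a b L y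
  cases s
  · simp [bridge, harmMin, show H (Sum.inr Reservoir.minus) = 0 from rfl, h1]
  · simp [bridge, harmMin, show H (Sum.inr Reservoir.plus) = 1 from rfl, h2]

theorem bridge_comm (x y : Site L) : bridge A B a b L x y = bridge A B a b L y x := by
  rw [bridge, bridge, harmMin, harmMin, min_comm, mul_comm]

theorem bridge_reservoir_right (s : Reservoir) (x : Site L) :
    bridge A B a b L x (Sum.inr s) = 0 := by
  rw [bridge_comm, bridge_reservoir_left]

theorem pairGen_bridge_bounds (hA : 0 < A) (hB : 0 < B) (x y : Site L) :
    β / 12 * bondCount x y ≤ -pairGen A B a b L (bridge A B a b L) x y ∧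
    -pairGen A B a b L (bridge A B a b L) x y ≤
      β / 3 * bondCount x y + sinkTerm A B a b L x y := by
  have h0 := harmSlope_pos (A := A) (B := B) a b L
  have h1 := harmSlope_le_half (A := A) (B := B) a b L
  have hn := bondCount_nonneg L x y
  have hs := sinkTerm_nonneg (A := A) (B := B) a b L x y
  have hc := pairCov_bounds (A := A) (B := B) a b L x y
  have e : pairGen A B a b L (bridge A B a b L) x y =
      -(β / 6) * bondCount x y - pairCov A B a b L x y := by
    rw [← pairGen_harmMin a b L hA hB, ← pairGen_harm_mul a b L hA hB, ← pairGen_sub]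
    rfl
  rw [e]
  have hb2 : β ^ 2 * bondCount x y ≤ β / 2 * bondCount x y :=
    mul_le_mul_of_nonneg_right (by nlinarith) hn
  constructor <;> linarith [hc.1, hc.2]

end

/-- The transition operator of two particles from one ring of the clocks to the next one. -/
def pairStep (A B : ℝ≥0) (a b : ℝ) (L : ℕ+) (φ : Site L → Site L → ℝ) (x y : Site L) : ℝ :=
  φ x y + (totalRate A B a b L : ℝ)⁻¹ * pairGen A B a b L φ x y

/-- The probability that two particles are both absorbed at `δ(+)`. -/
def pairHarm (A B : ℝ≥0) (a b : ℝ) (L : ℕ+) (x y : Site L) : ℝ :=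
  ⨅ n : ℕ, ((pairStep A B a b L)^[n] (harmMin A B a b L)) x y

/-- The covariance of the absorption of two particles at `δ(+)`, with a correction that makes it a
nonnegative superharmonic function. -/
def excess (A B : ℝ≥0) (a b : ℝ) (L : ℕ+) (x y : Site L) : ℝ :=
  pairHarm A B a b L x y - harm A B a b L x * harm A B a b L y +
    14 * harmSlope A B a b L * bridge A B a b L x y

section

variable {A B : ℝ≥0} (a b : ℝ) (L : ℕ+)

local notation "β" => harmSlope A B a b L
local notation "H" => harm A B a b L

theorem pairStep_eq (φ : Site L → Site L → ℝ) (x y : Site L) :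
    pairStep A B a b L φ x y = (totalRate A B a b L : ℝ)⁻¹ *
      ∑ e, (clockRate A B a b L e : ℝ) * pairOp e φ x y := by
  have hΛ : (totalRate A B a b L : ℝ) ≠ 0 := by exact_mod_cast (totalRate_pos A B a b L).ne'
  simp only [pairStep, pairGen, mul_sub, Finset.sum_sub_distrib, ← Finset.sum_mul,
    ← coe_totalRate]
  field_simp
  ring

theorem pairStep_monotone : Monotone (pairStep A B a b L) := by
  intro φ ψ h x y
  rw [pairStep_eq, pairStep_eq]
  gcongr
  exact pairOp_mono _ (fun u v => h u v) x y

theorem pairOp_eq_sum (e : Clock L) (φ : Site L → Site L → ℝ) (x y : Site L) :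
    pairOp e φ x y = ∑ s, ∑ t, (∫ p in (0 : ℝ)..1,
      siteOp e p (Pi.single s 1) x * siteOp e p (Pi.single t 1) y) * φ s t := by
  have h : ∀ p, pairSiteOp e p φ x y = ∑ s, ∑ t,
      siteOp e p (Pi.single s 1) x * siteOp e p (Pi.single t 1) y * φ s t := by
    intro p
    rw [pairSiteOp_eq_sum]
    refine Finset.sum_congr rfl fun s _ => ?_
    rw [siteOp_eq_sum e p (φ s), Finset.mul_sum]
    exact Finset.sum_congr rfl fun t _ => by ring
  have hc : ∀ s t, Continuous fun p =>
      siteOp e p (Pi.single s 1) x * siteOp e p (Pi.single t 1) y * φ s t := fun s t =>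
    ((continuous_siteOp _ _ _).mul (continuous_siteOp _ _ _)).mul continuous_const
  simp only [pairOp, h]
  rw [intervalIntegral.integral_finsetSum]
  · refine Finset.sum_congr rfl fun s _ => ?_
    rw [intervalIntegral.integral_finsetSum]
    · simp only [intervalIntegral.integral_mul_const]
    · exact fun t _ => (hc s t).intervalIntegrable _ _
  · exact fun s _ => (continuous_finsetSum _ fun t _ => hc s t).intervalIntegrable _ _

theorem tendsto_pairStep {φ : ℕ → Site L → Site L → ℝ} {ψ : Site L → Site L → ℝ}
    (h : ∀ x y, Tendsto (fun n => φ n x y) atTop (nhds (ψ x y))) (x y : Site L) :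
    Tendsto (fun n => pairStep A B a b L (φ n) x y) atTop (nhds (pairStep A B a b L ψ x y)) := by
  simp only [pairStep_eq, pairOp_eq_sum]
  exact (tendsto_finsetSum _ fun e _ => (tendsto_finsetSum _ fun s _ =>
    tendsto_finsetSum _ fun t _ => (h s t).const_mul _).const_mul _).const_mul _

theorem pairStep_harmMin_le (hA : 0 < A) (hB : 0 < B) :
    pairStep A B a b L (harmMin A B a b L) ≤ harmMin A B a b L := by
  intro x y
  rw [pairStep, pairGen_harmMin a b L hA hB]
  have h1 := mul_nonneg (harmSlope_pos (A := A) (B := B) a b L).le (bondCount_nonneg L x y)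
  have h2 : (0 : ℝ) ≤ (totalRate A B a b L : ℝ)⁻¹ := by positivity
  nlinarith [mul_nonneg h2 h1]

theorem le_pairStep_iterate {g : Site L → Site L → ℝ} (hg : g ≤ harmMin A B a b L)
    (hgen : ∀ x y, 0 ≤ pairGen A B a b L g x y) (n : ℕ) :
    g ≤ (pairStep A B a b L)^[n] (harmMin A B a b L) := by
  have h1 : g ≤ pairStep A B a b L g := by
    intro x y
    rw [pairStep]
    have h2 : (0 : ℝ) ≤ (totalRate A B a b L : ℝ)⁻¹ := by positivity
    linarith [mul_nonneg h2 (hgen x y)]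
  have h2 := (pairStep_monotone (A := A) (B := B) a b L).monotone_iterate_of_le_map h1
    (Nat.zero_le n)
  exact le_trans h2 ((pairStep_monotone (A := A) (B := B) a b L).iterate n hg)

theorem pairStep_iterate_nonneg (n : ℕ) (x y : Site L) :
    0 ≤ ((pairStep A B a b L)^[n] (harmMin A B a b L)) x y := by
  refine le_pairStep_iterate (A := A) (B := B) a b L (g := fun _ _ => 0) (fun x y => ?_)
    (fun x y => ?_) n x y
  · exact le_min (harm_nonneg a b L x) (harm_nonneg a b L y)
  · simp [pairGen, pairOp, pairSiteOp, siteOp_const]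

theorem tendsto_pairHarm (hA : 0 < A) (hB : 0 < B) (x y : Site L) :
    Tendsto (fun n => ((pairStep A B a b L)^[n] (harmMin A B a b L)) x y) atTop
      (nhds (pairHarm A B a b L x y)) := by
  refine tendsto_atTop_ciInf (fun m n hmn => ?_) ⟨0, ?_⟩
  · exact (pairStep_monotone (A := A) (B := B) a b L).antitone_iterate_of_map_le
      (pairStep_harmMin_le a b L hA hB) hmn x y
  · rintro _ ⟨n, rfl⟩
    exact pairStep_iterate_nonneg a b L n x y

theorem pairGen_pairHarm (hA : 0 < A) (hB : 0 < B) (x y : Site L) :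
    pairGen A B a b L (pairHarm A B a b L) x y = 0 := by
  have h1 := tendsto_pairStep (A := A) (B := B) a b L (tendsto_pairHarm a b L hA hB) x y
  have h2 := (tendsto_pairHarm (A := A) (B := B) a b L hA hB x y).comp (tendsto_add_atTop_nat 1)
  have h3 : ((fun n => ((pairStep A B a b L)^[n] (harmMin A B a b L)) x y) ∘ fun n => n + 1) =
      fun n => pairStep A B a b L ((pairStep A B a b L)^[n] (harmMin A B a b L)) x y := by
    funext n
    simp only [Function.comp, Function.iterate_succ_apply']
  rw [h3] at h2
  have h4 := tendsto_nhds_unique h1 h2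
  have hΛ : (totalRate A B a b L : ℝ) ≠ 0 := by exact_mod_cast (totalRate_pos A B a b L).ne'
  rw [pairStep, add_eq_left, mul_eq_zero] at h4
  exact h4.resolve_left (inv_ne_zero hΛ)

theorem pairHarm_le_harmMin (x y : Site L) :
    pairHarm A B a b L x y ≤ harmMin A B a b L x y :=
  ciInf_le ⟨0, by
    rintro _ ⟨n, rfl⟩
    exact pairStep_iterate_nonneg a b L n x y⟩ 0

theorem pairSiteOp_rank_mono (e : Clock L) {p : ℝ} (hp : p ∈ Set.Icc (0 : ℝ) 1)
    {φ : Site L → Site L → ℝ}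
    (hφ : ∀ x y x' y', rank x ≤ rank x' → rank y ≤ rank y' → φ x y ≤ φ x' y')
    {x y x' y' : Site L} (hx : rank x ≤ rank x') (hy : rank y ≤ rank y') :
    pairSiteOp e p φ x y ≤ pairSiteOp e p φ x' y' := by
  refine (siteOp_rank_mono L e hp (fun u v huv => ?_) hx).trans
    (siteOp_mono e hp (fun u => ?_) x')
  · exact siteOp_mono e hp (fun w => hφ u w v w huv le_rfl) y
  · exact siteOp_rank_mono L e hp (fun v w hvw => hφ u v u w le_rfl hvw) hy

theorem pairHarm_mono (hA : 0 < A) (hB : 0 < B) {x y x' y' : Site L} (hx : rank x ≤ rank x')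
    (hy : rank y ≤ rank y') : pairHarm A B a b L x y ≤ pairHarm A B a b L x' y' := by
  refine le_of_tendsto_of_tendsto' (tendsto_pairHarm a b L hA hB x y)
    (tendsto_pairHarm a b L hA hB x' y') fun n => ?_
  induction n generalizing x y x' y' with
  | zero => exact min_le_min (harm_mono a b L hx) (harm_mono a b L hy)
  | succ n ih =>
    simp only [Function.iterate_succ_apply', pairStep_eq]
    gcongr with e
    exact intervalIntegral.integral_mono_on zero_le_one
      ((continuous_pairSiteOp _ _ _ _).intervalIntegrable _ _)
      ((continuous_pairSiteOp _ _ _ _).intervalIntegrable _ _)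
      fun p hp => pairSiteOp_rank_mono L e hp (fun _ _ _ _ h h' => ih h h') hx hy

theorem pairGen_harm_mul_sub_bridge_nonneg (hA : 0 < A) (hB : 0 < B) (x y : Site L) :
    0 ≤ pairGen A B a b L (fun u v => H u * H v - 14 * β * bridge A B a b L u v) x y := by
  have h1 := pairCov_bounds (A := A) (B := B) a b L x y
  have h2 := pairGen_bridge_bounds a b L hA hB x y
  have hβ := harmSlope_pos (A := A) (B := B) a b L
  have hs := sinkTerm_nonneg (A := A) (B := B) a b L x y
  have hn := bondCount_nonneg L x y
  rw [pairGen_sub, pairGen_harm_mul a b L hA hB, pairGen_const_mul]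
  nlinarith [mul_le_mul_of_nonneg_left h2.1 hβ.le, mul_nonneg (sq_nonneg β) hn]

theorem excess_nonneg (hA : 0 < A) (hB : 0 < B) (x y : Site L) : 0 ≤ excess A B a b L x y := by
  have hβ := harmSlope_pos (A := A) (B := B) a b L
  have h : H x * H y - 14 * β * bridge A B a b L x y ≤ pairHarm A B a b L x y := by
    refine le_ciInf fun n => ?_
    refine le_pairStep_iterate (A := A) (B := B) a b L
      (g := fun u v => H u * H v - 14 * β * bridge A B a b L u v) (fun u v => ?_)
      (fun u v => pairGen_harm_mul_sub_bridge_nonneg a b L hA hB u v) n x y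
    have h1 := bridge_nonneg (A := A) (B := B) a b L u v
    have h2 := mul_nonneg hβ.le h1
    have h3 : bridge A B a b L u v = harmMin A B a b L u v - H u * H v := rfl
    change H u * H v - 14 * β * bridge A B a b L u v ≤ harmMin A B a b L u v
    linarith
  rw [excess]
  linarith

theorem excess_le (x y : Site L) :
    excess A B a b L x y ≤ (1 + 14 * β) * bridge A B a b L x y := by
  have h := pairHarm_le_harmMin (A := A) (B := B) a b L x y
  have h3 : bridge A B a b L x y = harmMin A B a b L x y - H x * H y := rfl
  rw [excess]
  linarith

theorem pairGen_excess (hA : 0 < A) (hB : 0 < B) (x y : Site L) :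
    pairGen A B a b L (excess A B a b L) x y =
      -pairCov A B a b L x y + 14 * β * pairGen A B a b L (bridge A B a b L) x y := by
  have h : excess A B a b L = fun u v => (pairHarm A B a b L u v - H u * H v) +
    14 * β * bridge A B a b L u v := rfl
  rw [h, pairGen_add, pairGen_sub, pairGen_pairHarm a b L hA hB, pairGen_harm_mul a b L hA hB,
    pairGen_const_mul]
  ring

theorem pairGen_excess_le (hA : 0 < A) (hB : 0 < B) (x y : Site L) :
    pairGen A B a b L (excess A B a b L) x y ≤ -pairSource A B a b L H x y := by
  have h1 := pairCov_bounds (A := A) (B := B) a b L x y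
  have h2 := pairGen_bridge_bounds a b L hA hB x y
  have h3 := pairSource_le (A := A) (B := B) a b L x y
  have hβ := harmSlope_pos (A := A) (B := B) a b L
  rw [pairGen_excess a b L hA hB]
  nlinarith [mul_le_mul_of_nonneg_left h2.1 hβ.le]

theorem neg_pairGen_excess_le (hA : 0 < A) (hB : 0 < B) (x y : Site L) :
    -pairGen A B a b L (excess A B a b L) x y ≤
      5 * β ^ 2 * bondCount x y + 8 * sinkTerm A B a b L x y := by
  have h1 := pairCov_bounds (A := A) (B := B) a b L x y
  have h2 := pairGen_bridge_bounds a b L hA hB x y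
  have hβ := harmSlope_pos (A := A) (B := B) a b L
  have hβ' := harmSlope_le_half (A := A) (B := B) a b L
  have hs := sinkTerm_nonneg (A := A) (B := B) a b L x y
  rw [pairGen_excess a b L hA hB]
  nlinarith [mul_le_mul_of_nonneg_left h2.2 hβ.le, mul_le_mul_of_nonneg_right hβ' hs]

end

/-- The reversible measure of two labelled particles. -/
def pairWeight {L : ℕ+} (x y : Site L) : ℝ := if x = y then 2 else 1

theorem bondLeft_ne_bondRight {L : ℕ+} (k : Set.Ico (-(L : ℤ)) (L : ℤ)) :
    bondLeft k ≠ bondRight k := by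
  rw [Ne, eq_iff_rank, rank_bondLeft, rank_bondRight]
  omega

theorem pairOp_bond_of_mem {L : ℕ+} {k : Set.Ico (-(L : ℤ)) (L : ℤ)} {x y : Site L}
    (hx : inBond k x) (hy : inBond k y) (f : Site L → Site L → ℝ) :
    pairOp (Sum.inl k) f x y = f (bondLeft k) (bondLeft k) / 3 + f (bondRight k) (bondRight k) / 3 +
      f (bondLeft k) (bondRight k) / 6 + f (bondRight k) (bondLeft k) / 6 := by
  have e : ∀ p, pairSiteOp (Sum.inl k) p f x y = f (bondRight k) (bondRight k) +
      (f (bondLeft k) (bondRight k) + f (bondRight k) (bondLeft k) -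
        2 * f (bondRight k) (bondRight k)) * p +
      (f (bondLeft k) (bondLeft k) + f (bondRight k) (bondRight k) -
        f (bondLeft k) (bondRight k) - f (bondRight k) (bondLeft k)) * p ^ 2 := by
    intro p
    rw [pairSiteOp, siteOp_bond_of_mem hx, siteOp_bond_of_mem hy, siteOp_bond_of_mem hy]
    ring
  simp only [pairOp, e, integral_quadratic]
  ring

theorem pairOp_bond_of_notMem {L : ℕ+} {k : Set.Ico (-(L : ℤ)) (L : ℤ)} {x y : Site L}
    (h : ¬(inBond k x ∧ inBond k y)) (f : Site L → Site L → ℝ) :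
    pairOp (Sum.inl k) f x y = (f x y + f (Equiv.swap (bondLeft k) (bondRight k) x)
      (Equiv.swap (bondLeft k) (bondRight k) y)) / 2 := by
  have hout : ∀ z, ¬inBond k z → Equiv.swap (bondLeft k) (bondRight k) z = z := by
    intro z hz
    rw [inBond, not_or] at hz
    exact Equiv.swap_apply_of_ne_of_ne hz.1 hz.2
  have hin : ∀ z, inBond k z → ∀ g : Site L → ℝ, g z + g (Equiv.swap (bondLeft k) (bondRight k) z) =
      g (bondLeft k) + g (bondRight k) := by
    rintro z (rfl | rfl) g
    · rw [Equiv.swap_apply_left]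
    · rw [Equiv.swap_apply_right, add_comm]
  by_cases hx : inBond k x
  · have hy : ¬inBond k y := fun hy => h ⟨hx, hy⟩
    have e : ∀ p, pairSiteOp (Sum.inl k) p f x y = f (bondRight k) y +
        (f (bondLeft k) y - f (bondRight k) y) * p + 0 * p ^ 2 := by
      intro p
      rw [pairSiteOp, siteOp_bond_of_mem hx, siteOp_bond_of_notMem hy, siteOp_bond_of_notMem hy]
      ring
    simp only [pairOp, e, integral_quadratic]
    rw [hout y hy, hin x hx fun z => f z y]
    ring
  · by_cases hy : inBond k y
    · have e : ∀ p, pairSiteOp (Sum.inl k) p f x y = f x (bondRight k) +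
          (f x (bondLeft k) - f x (bondRight k)) * p + 0 * p ^ 2 := by
        intro p
        rw [pairSiteOp, siteOp_bond_of_notMem hx, siteOp_bond_of_mem hy]
        ring
      simp only [pairOp, e, integral_quadratic]
      rw [hout x hx, hin y hy fun z => f x z]
      ring
    · rw [hout x hx, hout y hy]
      simp [pairOp, pairSiteOp, siteOp_bond_of_notMem hx, siteOp_bond_of_notMem hy]

theorem sum_pairOp_bond_symm {L : ℕ+} (k : Set.Ico (-(L : ℤ)) (L : ℤ))
    (f g : Site L → Site L → ℝ) :
    ∑ z : Site L × Site L, pairWeight z.1 z.2 * (g z.1 z.2 * pairOp (Sum.inl k) f z.1 z.2 -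
      f z.1 z.2 * pairOp (Sum.inl k) g z.1 z.2) = 0 := by
  classical
  set σ : Equiv.Perm (Site L) := Equiv.swap (bondLeft k) (bondRight k) with hσ
  have hne := bondLeft_ne_bondRight k
  have hσin : ∀ z, inBond k (σ z) ↔ inBond k z := by
    intro z
    simp only [inBond]
    rw [← Equiv.eq_symm_apply, ← Equiv.eq_symm_apply, hσ, Equiv.symm_swap,
      Equiv.swap_apply_left, Equiv.swap_apply_right, or_comm]
  rw [← Finset.sum_filter_add_sum_filter_not Finset.univ
    fun z : Site L × Site L => inBond k z.1 ∧ inBond k z.2]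
  have h1 : (Finset.univ.filter fun z : Site L × Site L => inBond k z.1 ∧ inBond k z.2) =
      ({bondLeft k, bondRight k} : Finset (Site L)) ×ˢ {bondLeft k, bondRight k} := by
    ext z
    rw [Finset.mem_filter, Finset.mem_product]
    simp [inBond]
  have h2 : ∀ z ∈ Finset.univ.filter fun z : Site L × Site L => ¬(inBond k z.1 ∧ inBond k z.2),
      pairWeight z.1 z.2 * (g z.1 z.2 * pairOp (Sum.inl k) f z.1 z.2 -
        f z.1 z.2 * pairOp (Sum.inl k) g z.1 z.2) =
      pairWeight z.1 z.2 * g z.1 z.2 * f (σ z.1) (σ z.2) / 2 -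
        pairWeight (σ z.1) (σ z.2) * g (σ z.1) (σ z.2) * f (σ (σ z.1)) (σ (σ z.2)) / 2 := by
    intro z hz
    have hw : pairWeight (σ z.1) (σ z.2) = pairWeight z.1 z.2 := by
      simp [pairWeight]
    have hinv : ∀ x, σ (σ x) = x := fun x => by
      rw [hσ, ← Equiv.trans_apply, Equiv.swap_swap, Equiv.refl_apply]
    rw [pairOp_bond_of_notMem (Finset.mem_filter.1 hz).2,
      pairOp_bond_of_notMem (Finset.mem_filter.1 hz).2, hw, hinv, hinv]
    ring
  rw [Finset.sum_congr rfl h2, Finset.sum_sub_distrib, h1]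
  have h3 : ∑ z ∈ Finset.univ.filter fun z : Site L × Site L => ¬(inBond k z.1 ∧ inBond k z.2),
      pairWeight z.1 z.2 * g z.1 z.2 * f (σ z.1) (σ z.2) / 2 =
      ∑ z ∈ Finset.univ.filter fun z : Site L × Site L => ¬(inBond k z.1 ∧ inBond k z.2),
      pairWeight (σ z.1) (σ z.2) * g (σ z.1) (σ z.2) * f (σ (σ z.1)) (σ (σ z.2)) / 2 := by
    rw [Finset.sum_filter, Finset.sum_filter, ← Equiv.sum_comp (Equiv.prodCongr σ σ)]
    refine Finset.sum_congr rfl fun z _ => ?_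
    simp only [Equiv.prodCongr_apply, Prod.map_fst, Prod.map_snd, hσin]
  rw [h3, sub_self, add_zero, Finset.sum_product, Finset.sum_pair hne, Finset.sum_pair hne,
    Finset.sum_pair hne]
  have hl : inBond k (bondLeft k) := Or.inl rfl
  have hr : inBond k (bondRight k) := Or.inr rfl
  simp only [pairOp_bond_of_mem hl hl, pairOp_bond_of_mem hl hr, pairOp_bond_of_mem hr hl,
    pairOp_bond_of_mem hr hr, pairWeight, if_true, if_neg hne, if_neg hne.symm]
  ring

/-- The label process of two particles is reversible. -/
theorem sum_pairGen_symm (A B : ℝ≥0) (a b : ℝ) (L : ℕ+) {f g : Site L → Site L → ℝ}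
    (hf1 : ∀ s y, f (Sum.inr s) y = 0) (hf2 : ∀ s x, f x (Sum.inr s) = 0)
    (hg1 : ∀ s y, g (Sum.inr s) y = 0) (hg2 : ∀ s x, g x (Sum.inr s) = 0) :
    ∑ z : Site L × Site L, pairWeight z.1 z.2 * (g z.1 z.2 * pairGen A B a b L f z.1 z.2) =
    ∑ z : Site L × Site L, pairWeight z.1 z.2 * (f z.1 z.2 * pairGen A B a b L g z.1 z.2) := by
  have hsink : ∀ (s : Reservoir) (x y : Site L),
      g x y * pairOp (Sum.inr s) f x y - f x y * pairOp (Sum.inr s) g x y = 0 := by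
    intro s x y
    simp only [pairOp, pairSiteOp, siteOp]
    split_ifs <;> simp [hf1, hf2, hg1, hg2, mul_comm]
  rw [← sub_eq_zero, ← Finset.sum_sub_distrib]
  have h1 : ∀ z : Site L × Site L,
      pairWeight z.1 z.2 * (g z.1 z.2 * pairGen A B a b L f z.1 z.2) -
        pairWeight z.1 z.2 * (f z.1 z.2 * pairGen A B a b L g z.1 z.2) =
      ∑ e, (clockRate A B a b L e : ℝ) * (pairWeight z.1 z.2 * (g z.1 z.2 * pairOp e f z.1 z.2 -
        f z.1 z.2 * pairOp e g z.1 z.2)) := by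
    intro z
    simp only [pairGen, Finset.mul_sum, ← Finset.sum_sub_distrib]
    exact Finset.sum_congr rfl fun e _ => by ring
  simp only [h1]
  rw [Finset.sum_comm]
  refine Finset.sum_eq_zero fun e _ => ?_
  rw [← Finset.mul_sum]
  rcases e with k | s
  · rw [sum_pairOp_bond_symm, mul_zero]
  · simp [hsink]

theorem sum_bondCount (L : ℕ+) :
    ∑ z : Site L × Site L, bondCount z.1 z.2 = 8 * (L : ℕ) := by
  classical
  have h1 : ∀ k : Set.Ico (-(L : ℤ)) (L : ℤ),
      ∑ z : Site L × Site L, (if inBond k z.1 ∧ inBond k z.2 then (1 : ℝ) else 0) = 4 := by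
    intro k
    have h2 : (Finset.univ.filter fun z : Site L × Site L => inBond k z.1 ∧ inBond k z.2) =
        ({bondLeft k, bondRight k} : Finset (Site L)) ×ˢ {bondLeft k, bondRight k} := by
      ext z
      rw [Finset.mem_filter, Finset.mem_product]
      simp [inBond]
    rw [Finset.sum_boole, h2, Finset.card_product, Finset.card_pair (bondLeft_ne_bondRight k)]
    norm_num
  simp only [bondCount]
  rw [Finset.sum_comm]
  simp only [h1, Finset.sum_const, Finset.card_univ, nsmul_eq_mul]
  have h3 : Fintype.card (Set.Ico (-(L : ℤ)) (L : ℤ)) = 2 * (L : ℕ) := by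
    rw [Fintype.card_ofFinset, Int.card_Ico]
    omega
  rw [h3]
  push_cast
  ring

section

variable {A B : ℝ≥0} (a b : ℝ) (L : ℕ+)

local notation "β" => harmSlope A B a b L
local notation "H" => harm A B a b L

theorem sum_sinkTerm_le (hA : 0 < A) (hB : 0 < B) :
    ∑ z : Site L × Site L, sinkTerm A B a b L z.1 z.2 ≤ β := by
  classical
  have hβ := harmSlope_pos (A := A) (B := B) a b L
  have h1 : ∀ s : Reservoir, ∑ z : Site L × Site L,
      (clockRate A B a b L (Sum.inr s) : ℝ) * (if z.1 = boundarySite L s ∧ z.2 = boundarySite L s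
        then (H (Sum.inr s) - H (boundarySite L s)) ^ 2 else 0) =
      clockRate A B a b L (Sum.inr s) * (H (Sum.inr s) - H (boundarySite L s)) ^ 2 := by
    intro s
    rw [← Finset.mul_sum, Finset.sum_eq_single (boundarySite L s, boundarySite L s)]
    · simp
    · intro z _ hz
      rw [if_neg]
      rintro ⟨h1, h2⟩
      exact hz (Prod.ext h1 h2)
    · simp
  have key : ∀ r d : ℝ, 0 < r → d = β * (2 * r)⁻¹ → d ≤ 1 → r * d ^ 2 ≤ β / 2 := by
    intro r d hr hd hd1
    have e : r * d ^ 2 = β / 2 * d := by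
      rw [sq, hd]
      field_simp
    rw [e]
    exact mul_le_of_le_one_right (by positivity) hd1
  have hm := key _ _ (clockRate_inr_pos hA hB a b L Reservoir.minus)
    (harm_minus (A := A) (B := B) a b L) (harm_le_one a b L _)
  have hp := key _ _ (clockRate_inr_pos hA hB a b L Reservoir.plus)
    (one_sub_harm_plus (A := A) (B := B) a b L)
    (sub_le_self _ (harm_nonneg (A := A) (B := B) a b L _))
  simp only [sinkTerm]
  rw [Finset.sum_comm]
  simp only [h1, sum_reservoir]
  rw [show H (Sum.inr Reservoir.minus) = 0 from rfl, show H (Sum.inr Reservoir.plus) = 1 from rfl,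
    zero_sub, neg_sq]
  linarith

theorem one_le_bondCount_self (x : Chain L) : 1 ≤ bondCount (Sum.inl x : Site L) (Sum.inl x) := by
  have hL : (1 : ℤ) ≤ L := by exact_mod_cast L.pos
  have hx1 := x.2.1
  have hx2 := x.2.2
  obtain ⟨k, hk⟩ : ∃ k : Set.Ico (-(L : ℤ)) (L : ℤ), inBond k (Sum.inl x : Site L) := by
    by_cases h : (x : ℤ) < L
    · exact ⟨⟨x, hx1, h⟩, Or.inl rfl⟩
    · refine ⟨⟨(x : ℤ) - 1, by omega, by omega⟩, inBond_iff_rank.2 (Or.inr ?_)⟩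
      simp
  have h := Finset.single_le_sum
    (f := fun k => if inBond k (Sum.inl x : Site L) ∧ inBond k (Sum.inl x : Site L)
      then (1 : ℝ) else 0)
    (fun k _ => by split_ifs <;> norm_num) (Finset.mem_univ k)
  simpa [hk, bondCount] using h

theorem excess_eq_zero {x y : Site L} (hA : 0 < A) (hB : 0 < B)
    (h : bridge A B a b L x y = 0) : excess A B a b L x y = 0 := by
  refine le_antisymm ?_ (excess_nonneg a b L hA hB x y)
  have := excess_le (A := A) (B := B) a b L x y
  rwa [h, mul_zero] at this

theorem sum_excess_diag_le (hA : 0 < A) (hB : 0 < B) :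
    ∑ x : Chain L, excess A B a b L (Sum.inl x) (Sum.inl x) ≤ 672 := by
  have hβ := harmSlope_pos (A := A) (B := B) a b L
  have hR := excess_nonneg (A := A) (B := B) a b L hA hB
  have hsymm := sum_pairGen_symm A B a b L (f := excess A B a b L) (g := bridge A B a b L)
    (fun s y => excess_eq_zero a b L hA hB (bridge_reservoir_left a b L s y))
    (fun s x => excess_eq_zero a b L hA hB (bridge_reservoir_right a b L s x))
    (bridge_reservoir_left a b L) (bridge_reservoir_right a b L)
  have hw0 : ∀ x y : Site L, 1 ≤ pairWeight x y := by
    intro x y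
    unfold pairWeight
    split_ifs <;> norm_num
  have hw1 : ∀ x y : Site L, pairWeight x y ≤ 2 := by
    intro x y
    unfold pairWeight
    split_ifs <;> norm_num
  have hupper : -∑ z : Site L × Site L, pairWeight z.1 z.2 *
      (bridge A B a b L z.1 z.2 * pairGen A B a b L (excess A B a b L) z.1 z.2) ≤ 56 * β := by
    calc _ = ∑ z : Site L × Site L, (pairWeight z.1 z.2 * bridge A B a b L z.1 z.2) *
          -pairGen A B a b L (excess A B a b L) z.1 z.2 := by
          rw [← Finset.sum_neg_distrib]
          exact Finset.sum_congr rfl fun z _ => by ring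
      _ ≤ ∑ z : Site L × Site L, 2 *
          (5 * β ^ 2 * bondCount z.1 z.2 + 8 * sinkTerm A B a b L z.1 z.2) := by
          refine Finset.sum_le_sum fun z _ => ?_
          have h1 := bridge_nonneg (A := A) (B := B) a b L z.1 z.2
          have h2 := bridge_le_one (A := A) (B := B) a b L z.1 z.2
          have h3 := bondCount_nonneg L z.1 z.2
          have h4 := sinkTerm_nonneg (A := A) (B := B) a b L z.1 z.2
          have h5 := hw0 z.1 z.2
          have h6 := hw1 z.1 z.2
          refine mul_le_mul_of_nonneg (by nlinarith)
            (neg_pairGen_excess_le a b L hA hB z.1 z.2) (by positivity) (by positivity)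
      _ = 10 * β ^ 2 * (8 * (L : ℕ)) + 16 * ∑ z : Site L × Site L,
          sinkTerm A B a b L z.1 z.2 := by
          rw [← sum_bondCount, Finset.mul_sum, Finset.mul_sum, ← Finset.sum_add_distrib]
          exact Finset.sum_congr rfl fun z _ => by ring
      _ ≤ 56 * β := by
          have h1 := sum_sinkTerm_le (A := A) (B := B) a b L hA hB
          have h2 := harmSlope_mul_le (A := A) (B := B) a b L
          nlinarith
  have hlower : β / 12 * ∑ x : Chain L, excess A B a b L (Sum.inl x) (Sum.inl x) ≤
      -∑ z : Site L × Site L, pairWeight z.1 z.2 *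
        (excess A B a b L z.1 z.2 * pairGen A B a b L (bridge A B a b L) z.1 z.2) := by
    have hterm : ∀ x y : Site L, β / 12 * bondCount x y * excess A B a b L x y ≤
        -(pairWeight x y *
          (excess A B a b L x y * pairGen A B a b L (bridge A B a b L) x y)) := by
      intro x y
      have h1 := (pairGen_bridge_bounds a b L hA hB x y).1
      have h2 := bondCount_nonneg L x y
      have h3 := hw0 x y
      have h4 : 0 ≤ β / 12 * bondCount x y := by positivity
      have h5 := mul_le_mul_of_nonneg_right h1 (hR x y)
      have h6 := mul_nonneg h4 (hR x y)
      nlinarith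
    have hterm0 : ∀ x y : Site L, 0 ≤ -(pairWeight x y *
        (excess A B a b L x y * pairGen A B a b L (bridge A B a b L) x y)) := fun x y =>
      (mul_nonneg (mul_nonneg (by positivity) (bondCount_nonneg L x y)) (hR x y)).trans
        (hterm x y)
    rw [← Finset.sum_neg_distrib, Fintype.sum_prod_type, Fintype.sum_sum_type, Finset.mul_sum]
    refine le_add_of_le_of_nonneg (Finset.sum_le_sum fun x _ => ?_)
      (Finset.sum_nonneg fun s _ => Finset.sum_nonneg fun y _ => hterm0 _ _)
    refine le_trans ?_ (Finset.single_le_sum (fun y _ => hterm0 (Sum.inl x) y)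
      (Finset.mem_univ (Sum.inl x)))
    refine le_trans ?_ (hterm _ _)
    refine mul_le_mul_of_nonneg_right ?_ (hR _ _)
    exact le_mul_of_one_le_right (by positivity) (one_le_bondCount_self L x)
  rw [hsymm] at hupper
  have h : β / 12 * ∑ x : Chain L, excess A B a b L (Sum.inl x) (Sum.inl x) ≤ β / 12 * 672 := by
    linarith
  exact le_of_mul_le_mul_left h (by positivity)

theorem harm_sub (x y : Chain L) :
    H (Sum.inl x) - H (Sum.inl y) = β * ((x : ℤ) - (y : ℤ) : ℝ) := by
  simp only [harm]
  ring

/-- Two particles started near `k` are absorbed almost independently. -/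
theorem excess_le_of_near (hA : 0 < A) (hB : 0 < B) (M J : ℕ) (k x y : Chain L)
    (hJ : (k : ℤ) + J ≤ L) (hx1 : (k : ℤ) - M ≤ x) (hx2 : x ≤ k) (hy1 : (k : ℤ) - M ≤ y)
    (hy2 : y ≤ k) :
    excess A B a b L (Sum.inl x) (Sum.inl y) ≤ 672 / (J + 1) + (J + M + 7) / (L : ℕ) := by
  classical
  have hL : (0 : ℝ) < (L : ℕ) := by exact_mod_cast L.pos
  have hβ := harmSlope_pos (A := A) (B := B) a b L
  have hβL := harmSlope_mul_le (A := A) (B := B) a b L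
  have h0 := harm_nonneg (A := A) (B := B) a b L
  have h1 := harm_le_one (A := A) (B := B) a b L
  have hR := excess_nonneg (A := A) (B := B) a b L hA hB
  set c : ℝ := pairHarm A B a b L (Sum.inl k) (Sum.inl k) - H (Sum.inl k) ^ 2 with hc
  have hdiag : ∀ z : Chain L, k ≤ z → (z : ℤ) ≤ k + J →
      c - 2 * β * J ≤ excess A B a b L (Sum.inl z) (Sum.inl z) := by
    intro z hz1 hz2
    have hm := pairHarm_mono (A := A) (B := B) a b L hA hB (x := Sum.inl k) (y := Sum.inl k)
      (x' := Sum.inl z) (y' := Sum.inl z) hz1 hz1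
    have hd := harm_sub (A := A) (B := B) a b L z k
    have hz2' : ((z : ℤ) - (k : ℤ) : ℝ) ≤ J := by
      have : (z : ℤ) - k ≤ J := by omega
      exact_mod_cast this
    have hd1 : H (Sum.inl z) - H (Sum.inl k) ≤ β * J := by
      rw [hd]
      gcongr
    have hd0 : 0 ≤ H (Sum.inl z) - H (Sum.inl k) := by
      rw [sub_nonneg]
      exact harm_chain_mono a b L hz1
    have hb := mul_nonneg hβ.le (bridge_nonneg (A := A) (B := B) a b L (Sum.inl z) (Sum.inl z))
    have hsum : H (Sum.inl z) + H (Sum.inl k) ≤ 2 := by linarith [h1 (Sum.inl z), h1 (Sum.inl k)]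
    have hsq : H (Sum.inl z) * H (Sum.inl z) - H (Sum.inl k) ^ 2 ≤ 2 * (β * J) := by
      have e : H (Sum.inl z) * H (Sum.inl z) - H (Sum.inl k) ^ 2 =
          (H (Sum.inl z) + H (Sum.inl k)) * (H (Sum.inl z) - H (Sum.inl k)) := by ring
      rw [e]
      exact mul_le_mul hsum hd1 hd0 (by norm_num)
    rw [excess]
    linarith
  have hc1 : ((J : ℝ) + 1) * (c - 2 * β * J) ≤ 672 := by
    let z : Fin (J + 1) → Chain L := fun j => ⟨(k : ℤ) + (j : ℕ), by
      have := k.2.1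
      omega, by
      have := j.2
      omega⟩
    have hz : Function.Injective z := by
      intro i j hij
      have := congrArg Subtype.val hij
      simp only [z] at this
      exact Fin.ext (by omega)
    calc ((J : ℝ) + 1) * (c - 2 * β * J) = ∑ _j : Fin (J + 1), (c - 2 * β * J) := by
          simp [mul_sub]
      _ ≤ ∑ j : Fin (J + 1), excess A B a b L (Sum.inl (z j)) (Sum.inl (z j)) := by
          refine Finset.sum_le_sum fun j _ => hdiag _ ?_ ?_
          · change (k : ℤ) ≤ (k : ℤ) + (j : ℕ)
            omega
          · change (k : ℤ) + (j : ℕ) ≤ (k : ℤ) + J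
            have := j.2
            omega
      _ = ∑ x ∈ Finset.univ.image z, excess A B a b L (Sum.inl x) (Sum.inl x) := by
          rw [Finset.sum_image fun _ _ _ _ h => hz h]
      _ ≤ ∑ x : Chain L, excess A B a b L (Sum.inl x) (Sum.inl x) :=
          Finset.sum_le_sum_of_subset_of_nonneg (Finset.subset_univ _) fun _ _ _ => hR _ _
      _ ≤ 672 := sum_excess_diag_le a b L hA hB
  have hc2 : c ≤ 672 / (J + 1) + 2 * β * J := by
    rw [mul_comm, ← le_div_iff₀ (by positivity)] at hc1
    linarith
  have hnear : ∀ w : Chain L, (k : ℤ) - M ≤ w → H (Sum.inl k) - H (Sum.inl w) ≤ β * M := by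
    intro w hw
    rw [harm_sub]
    have : ((k : ℤ) - (w : ℤ) : ℝ) ≤ M := by
      have : (k : ℤ) - w ≤ M := by omega
      exact_mod_cast this
    gcongr
  have hprod : H (Sum.inl k) ^ 2 - H (Sum.inl x) * H (Sum.inl y) ≤ 2 * (β * M) := by
    have e : H (Sum.inl k) ^ 2 - H (Sum.inl x) * H (Sum.inl y) =
        H (Sum.inl k) * (H (Sum.inl k) - H (Sum.inl x)) +
          H (Sum.inl x) * (H (Sum.inl k) - H (Sum.inl y)) := by ring
    have hβM : 0 ≤ β * M := by positivity
    have h2 : H (Sum.inl k) * (H (Sum.inl k) - H (Sum.inl x)) ≤ β * M :=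
      (mul_le_mul_of_nonneg_left (hnear x hx1) (h0 _)).trans (mul_le_of_le_one_left hβM (h1 _))
    have h3 : H (Sum.inl x) * (H (Sum.inl k) - H (Sum.inl y)) ≤ β * M :=
      (mul_le_mul_of_nonneg_left (hnear y hy1) (h0 _)).trans (mul_le_of_le_one_left hβM (h1 _))
    rw [e]
    linarith
  have hm := pairHarm_mono (A := A) (B := B) a b L hA hB (x := Sum.inl x) (y := Sum.inl y)
    (x' := Sum.inl k) (y' := Sum.inl k) hx2 hy2
  have hb := mul_le_mul_of_nonneg_left
    (bridge_le_one (A := A) (B := B) a b L (Sum.inl x) (Sum.inl y)) hβ.le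
  have hfin : β * (2 * (J + M + 7)) ≤ (J + M + 7) / (L : ℕ) := by
    rw [le_div_iff₀ hL]
    have : (0 : ℝ) ≤ J + M + 7 := by positivity
    nlinarith
  rw [excess]
  linarith

end

theorem abs_hitProb_sub_prod_hitProb_le {A B : ℝ≥0} (hA : 0 < A) (hB : 0 < B) (a b : ℝ) (L : ℕ+)
    {N : ℕ} (x : Fin N → Chain L) (ε : Fin N → Reservoir) :
    |hitProb A B a b L x ε - ∏ i, hitProb A B a b L (fun _ : Fin 1 => x i) fun _ => ε i| ≤
      ∑ q ∈ Finset.univ.offDiag, excess A B a b L (Sum.inl (x q.1)) (Sum.inl (x q.2)) := by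
  obtain ⟨t, ht0, ht⟩ := exists_siteGen_le_neg_alive a b L hA hB
  have h := fun (n : ℕ) (x : Fin n → Chain L) (ε : Fin n → Reservoir) =>
    abs_hitProb_sub_prod_le A B a b L (siteGen_harm a b L hA hB) (harm_nonneg a b L)
    (harm_le_one a b L) rfl rfl ht0 ht (excess_nonneg a b L hA hB)
    (pairGen_excess_le a b L hA hB) x ε
  have h1 : ∀ i, hitProb A B a b L (fun _ : Fin 1 => x i) (fun _ => ε i) =
      towards (harm A B a b L) (ε i) (Sum.inl (x i)) := by
    intro i
    have h2 := h 1 (fun _ => x i) fun _ => ε i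
    have h3 : (Finset.univ : Finset (Fin 1)).offDiag = ∅ := rfl
    rw [h3, Finset.sum_empty, Fin.prod_univ_one] at h2
    exact sub_eq_zero.1 (abs_nonpos_iff.1 h2)
  simp only [h1]
  exact h N x ε

theorem tendsto_pnat_cast_real_atTop : Tendsto (fun L : ℕ+ => ((L : ℕ) : ℝ)) atTop atTop :=
  tendsto_natCast_atTop_atTop.comp
    (tendsto_atTop.2 fun n => by
      filter_upwards [eventually_ge_atTop (⟨n + 1, n.succ_pos⟩ : ℕ+)] with L hL
      have : n + 1 ≤ (L : ℕ) := hL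
      omega)

theorem eventually_add_floor_mem {u : ℝ} (hu : u ∈ Set.Ioo (-1 : ℝ) 1) (m : ℤ) :
    ∀ᶠ L : ℕ+ in atTop, m + ⌊u * (L : ℕ)⌋ ∈ Set.Icc (-(L : ℤ)) (L : ℤ) := by
  have hcast := tendsto_pnat_cast_real_atTop
  have h1 := (hcast.const_mul_atTop (sub_pos.2 hu.2)).eventually_ge_atTop (m : ℝ)
  have h2 := (hcast.const_mul_atTop (by linarith [hu.1] : (0 : ℝ) < 1 + u)).eventually_ge_atTop
    (1 - (m : ℝ))
  filter_upwards [h1, h2] with L h1 h2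
  have h3 := Int.floor_le (u * (L : ℕ))
  have h4 := Int.lt_floor_add_one (u * (L : ℕ))
  have e1 : (-(L : ℕ) : ℝ) ≤ m + ⌊u * (L : ℕ)⌋ := by linarith
  have e2 : (m + ⌊u * (L : ℕ)⌋ : ℝ) ≤ (L : ℕ) := by linarith
  constructor
  · exact_mod_cast e1
  · exact_mod_cast e2

end

theorem proposition4p5 (A B : ℝ≥0) (hA : 0 < A) (hB : 0 < B) (a b : ℝ) (N : ℕ)
    (x : Fin N → ℤ) (ε : Fin N → Reservoir) (u : ℝ) (hu : u ∈ Set.Ioo (-1 : ℝ) 1) :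
    (∀ᶠ L : ℕ+ in atTop, ∀ i, x i + ⌊u * (L : ℕ)⌋ ∈ Set.Icc (-(L : ℤ)) (L : ℤ)) ∧
    Tendsto (fun L : ℕ+ =>
      if h : ∀ i, x i + ⌊u * (L : ℕ)⌋ ∈ Set.Icc (-(L : ℤ)) (L : ℤ) then
        hitProb A B a b L (fun i => ⟨x i + ⌊u * (L : ℕ)⌋, h i⟩) ε -
          ∏ i, hitProb A B a b L (fun _ : Fin 1 => ⟨x i + ⌊u * (L : ℕ)⌋, h i⟩) (fun _ => ε i)
      else 0) atTop (nhds 0) := by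
  refine ⟨eventually_all.2 fun i => eventually_add_floor_mem hu (x i), ?_⟩
  obtain ⟨M, hM⟩ : ∃ M : ℕ, ∀ i, |x i| ≤ M :=
    ⟨Finset.univ.sup fun i => (x i).natAbs, fun i => by
      have h := Finset.le_sup (f := fun i => (x i).natAbs) (Finset.mem_univ i)
      have h' : (x i).natAbs ≤ Finset.univ.sup fun i => (x i).natAbs := h
      rw [Int.abs_eq_natAbs]
      exact_mod_cast h'⟩
  have hcast := tendsto_pnat_cast_real_atTop
  rw [Metric.tendsto_nhds]
  intro δ hδ
  set D : ℝ := ((Finset.univ : Finset (Fin N)).offDiag.card : ℝ) with hD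
  have hD0 : 0 ≤ D := Nat.cast_nonneg _
  obtain ⟨J, hJ⟩ : ∃ J : ℕ, D * (672 / ((J : ℝ) + 1)) < δ / 2 := by
    obtain ⟨J, hJ⟩ := exists_nat_gt (D * 672 / (δ / 2))
    refine ⟨J, ?_⟩
    rw [div_lt_iff₀ (by positivity)] at hJ
    rw [← mul_div_assoc, div_lt_iff₀ (by positivity)]
    nlinarith
  have hlim : ∀ᶠ L : ℕ+ in atTop, D * (((J : ℝ) + (2 * M : ℕ) + 7) / (L : ℕ)) < δ / 2 := by
    have h1 : Tendsto (fun L : ℕ+ => D * (((J : ℝ) + (2 * M : ℕ) + 7) / (L : ℕ))) atTop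
        (nhds (D * 0)) := (hcast.const_div_atTop _).const_mul _
    rw [mul_zero] at h1
    exact h1.eventually_lt_const (half_pos hδ)
  filter_upwards [hlim, eventually_add_floor_mem hu (M : ℤ),
    eventually_add_floor_mem hu ((M : ℤ) + J)] with L h1 hk hkJ
  rw [dist_zero_right, Real.norm_eq_abs]
  split_ifs with h
  · refine (abs_hitProb_sub_prod_hitProb_le hA hB a b L _ ε).trans_lt ?_
    refine (Finset.sum_le_card_nsmul _ _
      (672 / ((J : ℝ) + 1) + ((J : ℝ) + (2 * M : ℕ) + 7) / (L : ℕ)) fun q _ => ?_).trans_lt ?_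
    · have hb1 := abs_le.1 (hM q.1)
      have hb2 := abs_le.1 (hM q.2)
      refine excess_le_of_near a b L hA hB (2 * M) J ⟨(M : ℤ) + ⌊u * (L : ℕ)⌋, hk⟩ _ _ ?_ ?_ ?_ ?_ ?_
      · have := hkJ.2
        simp only
        omega
      · simp only
        push_cast
        omega
      · rw [Subtype.mk_le_mk]
        omega
      · simp only
        push_cast
        omega
      · rw [Subtype.mk_le_mk]
        omega
    · rw [nsmul_eq_mul, mul_add]
      linarith
  · simpa using hδ
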